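/- Let $n$ be a natural number and $\mathbb B^{n+1}$ the open unit ball of $\mathbb R^{n+1}$. There are constants $b=b(n)>0$, $c=c(n)>0$ and $\varepsilon_0=\varepsilon_0(n)>0$ such that the following holds. Let $h$ be an $\eta$-admissible Einstein metric on $\mathbb B^{n+1}$, that is: $(1-|x|^2)^2h$ extends to a metric of class $C^{3,\alpha}$ on the closed ball for some $0<\alpha<1$; the conformal class on $\mathbb S^n$ which this extension induces (the conformal infinity of $h$) has positive Yamabe invariant; $\mathrm{Rc}(h)=-n\,h$; and $\sup_{\mathbb B^{n+1}}|E|_h\le\eta$, where $E=R+R^{cc}$, $R$ is the curvature $4$-tensor of $h$ (with the sign convention that $R_{ijji}>0$ on round spheres) and $R^{cc}_{ijkl}=h_{il}h_{jk}-h_{ik}h_{jl}$. Let $0<\varepsilon\le\varepsilon_0$, and let $g(t)$, $t\in(0,T)$, be a family of Riemannian metrics on $\mathbb B^{n+1}$, of class $C^2$ on $\mathbb B^{n+1}\times(0,T)$ (in particular, it may be in $\mathcal M^\infty(\mathbb B^{n+1},(0,T))$), that solves the normalized Ricci–DeTurck flow $$\partial_t g_{ij}=-2n\,g_{ij}-2\,\mathrm{Rc}(g)_{ij}+\nabla^g_iW_j+\nabla^g_jW_i,\qquad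 W^k=g^{pq}\big(\Gamma(g)^k_{pq}-\Gamma(h)^k_{pq}\big),$$ and that is $\varepsilon$-close to $h$: $(1+\varepsilon)^{-1}h\le g(t)\le(1+\varepsilon)h$ on $\mathbb B^{n+1}$ for all $t\in(0,T)$. Then at every point of $\mathbb B^{n+1}\times(0,T)$, $$\partial_t|g-h|^2\le g^{ij}\nabla_i\nabla_j|g-h|^2-(2-c\,\varepsilon)\,|\nabla(g-h)|^2+(4+c\,\varepsilon+b\,\eta)\,|g-h|^2,$$ where norms and covariant derivatives are with respect to $h$. Moreover, the curvature-error term satisfies $$\Big|\,4\,h^{ik}h^{jl}(g-h)_{kl}\;g^{ab}g_{ip}h^{pq}E_{jaqb}\Big|\le b\,\eta\,|g-h|^2 .$$ -/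

import Mathlib

open Set Metric MeasureTheory
open scoped NNReal ContDiff

/-- Points of `ℝ^d`; the standard coordinates are global coordinates on the open unit ball. -/
abbrev Pt (d : ℕ) : Type := EuclideanSpace ℝ (Fin d)

/-- A field of covariant `2`-tensors on (an open subset of) `ℝ^d`, by its components `g x i j`. -/
abbrev TensorField (d : ℕ) : Type := Pt d → Matrix (Fin d) (Fin d) ℝ

noncomputable section

/-! ### Riemannian geometry in coordinates -/

/-- The partial derivative `∂_i f` at `x`. -/
def pd {d : ℕ} (i : Fin d) (f : Pt d → ℝ) (x : Pt d) : ℝ :=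
  fderiv ℝ f x (EuclideanSpace.single i 1)

/-- The Christoffel symbol `Γ^k_{ij}` of `g`. -/
def christoffel {d : ℕ} (g : TensorField d) (k i j : Fin d) (x : Pt d) : ℝ :=
  (1 / 2) * ∑ l, (g x)⁻¹ k l *
    (pd i (fun y => g y j l) x + pd j (fun y => g y i l) x - pd l (fun y => g y i j) x)

/-- The component `R_{ijk}^l` of the curvature tensor:
`R(∂_i, ∂_j) ∂_k = ∇_i ∇_j ∂_k - ∇_j ∇_i ∂_k = ∑ l, R_{ijk}^l ∂_l`. -/
def riemannUp {d : ℕ} (g : TensorField d) (i j k l : Fin d) (x : Pt d) : ℝ :=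
  pd i (christoffel g l j k) x - pd j (christoffel g l i k) x
    + ∑ m, (christoffel g l i m x * christoffel g m j k x
      - christoffel g l j m x * christoffel g m i k x)

/-- The curvature `4`-tensor `R_{ijkl}`, with the index lowered to the fourth slot, so that
`R_{ijji}` is positive on a round sphere. -/
def riemann {d : ℕ} (g : TensorField d) (i j k l : Fin d) (x : Pt d) : ℝ :=
  ∑ m, g x l m * riemannUp g i j k m x

/-- The Ricci tensor `Rc_{jk} = R_{ijk}^i`. -/
def ricci {d : ℕ} (g : TensorField d) (j k : Fin d) (x : Pt d) : ℝ :=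
  ∑ i, riemannUp g i j k i x

/-- The scalar curvature. -/
def scalarCurvature {d : ℕ} (g : TensorField d) (x : Pt d) : ℝ :=
  ∑ j, ∑ k, (g x)⁻¹ j k * ricci g j k x

/-- The curvature `4`-tensor `R^{cc}` of constant sectional curvature `+1`. -/
def curvatureCC {d : ℕ} (h : TensorField d) (i j k l : Fin d) (x : Pt d) : ℝ :=
  h x i l * h x j k - h x i k * h x j l

/-- The curvature deviation from hyperbolic space, `E = R + R^{cc}`. -/
def curvatureError {d : ℕ} (h : TensorField d) (i j k l : Fin d) (x : Pt d) : ℝ :=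
  riemann h i j k l x + curvatureCC h i j k l x

/-- The covariant derivative `∇_a α_i` of a `1`-form `α` with respect to `h`. -/
def nabla1 {d : ℕ} (h : TensorField d) (α : Fin d → Pt d → ℝ) (a i : Fin d) (x : Pt d) : ℝ :=
  pd a (α i) x - ∑ m, christoffel h m a i x * α m x

/-- The covariant derivative `∇_a Z_{ij}` of a `2`-tensor `Z` with respect to `h`. -/
def nabla2 {d : ℕ} (h Z : TensorField d) (a i j : Fin d) (x : Pt d) : ℝ :=
  pd a (fun y => Z y i j) x
    - ∑ m, (christoffel h m a i x * Z x m j + christoffel h m a j x * Z x i m)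

/-- The second covariant derivative `∇_i ∇_j f` of a function with respect to `h`. -/
def hess {d : ℕ} (h : TensorField d) (f : Pt d → ℝ) (i j : Fin d) (x : Pt d) : ℝ :=
  nabla1 h (fun m => pd m f) i j x

/-- `|A|²` for a covariant `2`-tensor at a point, with respect to the inner product `q`. -/
def normSq2 {d : ℕ} (q A : Matrix (Fin d) (Fin d) ℝ) : ℝ :=
  ∑ i, ∑ j, ∑ i', ∑ j', q⁻¹ i i' * q⁻¹ j j' * A i j * A i' j'

/-- `|A|²` for a covariant `3`-tensor at a point, with respect to the inner product `q`. -/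
def normSq3 {d : ℕ} (q : Matrix (Fin d) (Fin d) ℝ) (A : Fin d → Fin d → Fin d → ℝ) : ℝ :=
  ∑ i, ∑ j, ∑ k, ∑ i', ∑ j', ∑ k', q⁻¹ i i' * q⁻¹ j j' * q⁻¹ k k' * A i j k * A i' j' k'

/-- `|A|²` for a covariant `4`-tensor at a point, with respect to the inner product `q`. -/
def normSq4 {d : ℕ} (q : Matrix (Fin d) (Fin d) ℝ)
    (A : Fin d → Fin d → Fin d → Fin d → ℝ) : ℝ :=
  ∑ i, ∑ j, ∑ k, ∑ l, ∑ i', ∑ j', ∑ k', ∑ l',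
    q⁻¹ i i' * q⁻¹ j j' * q⁻¹ k k' * q⁻¹ l l' * A i j k l * A i' j' k' l'

/-! ### The Yamabe invariant of a conformal class on the unit sphere -/

/-- For a field `q` of inner products on `ℝ^d` along the unit sphere and a positive function `φ`
on the sphere, this is the product metric `dr²/r² + φ² q|_{TS}` on `ℝ^d ∖ {0} ≅ (0,∞) × S`,
in the coordinates of `ℝ^d`: with `π z = z / |z|` and `P = 1 - z zᵀ / |z|²`, it is
`z_i z_j / |z|⁴ + φ(π z)² (P q(π z) P)_{ij} / |z|²`. At points of the unit sphere its scalar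
curvature is that of the metric `φ² q|_{TS}`, and the square root of its determinant is the density
of the volume of `φ² q|_{TS}` with respect to the round surface measure. -/
def cylinderMetric {d : ℕ} (q : TensorField d) (φ : Pt d → ℝ) : TensorField d := fun z =>
  let P : Matrix (Fin d) (Fin d) ℝ := 1 - Matrix.of fun i j => z i * z j / ‖z‖ ^ 2
  Matrix.of fun i j => z i * z j / ‖z‖ ^ 4
    + φ (‖z‖⁻¹ • z) ^ 2 * (P * q (‖z‖⁻¹ • z) * P) i j / ‖z‖ ^ 2

/-- The volume of the unit sphere for the metric `φ² q|_{TS}`. -/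
def sphereVolume {d : ℕ} (q : TensorField d) (φ : Pt d → ℝ) : ℝ :=
  ∫ z : sphere (0 : Pt d) 1, Real.sqrt (cylinderMetric q φ z).det
    ∂((volume : Measure (Pt d)).toSphere)

/-- The total scalar curvature of the unit sphere for the metric `φ² q|_{TS}`. -/
def sphereTotalScalar {d : ℕ} (q : TensorField d) (φ : Pt d → ℝ) : ℝ :=
  ∫ z : sphere (0 : Pt d) 1, scalarCurvature (cylinderMetric q φ) z
      * Real.sqrt (cylinderMetric q φ z).det
    ∂((volume : Measure (Pt d)).toSphere)

/-- The Yamabe invariant of the conformal class of `q|_{TS}` on the unit sphere `S` of `ℝ^(n+1)`: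
the infimum of `(∫ Scal dvol) / Vol ^ ((n-2)/n)` over the metrics `φ² q|_{TS}` with `φ` smooth and
positive. -/
def yamabeInvariant (n : ℕ) (q : TensorField (n + 1)) : ℝ :=
  sInf {Y : ℝ | ∃ φ : Pt (n + 1) → ℝ, ContDiff ℝ ∞ φ ∧
    (∀ z ∈ sphere (0 : Pt (n + 1)) 1, 0 < φ z) ∧
    Y = sphereTotalScalar q φ / sphereVolume q φ ^ (((n : ℝ) - 2) / (n : ℝ))}

/-! ### Admissible Einstein metrics -/

/-- `hbar` is a `C^{3,α}` metric on the closed unit ball, for some `0 < α < 1`. -/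
def IsHolderMetricOnClosedBall {d : ℕ} (hbar : TensorField d) : Prop :=
  (∀ x ∈ closedBall (0 : Pt d) 1, (hbar x).PosDef) ∧
  ∃ α : ℝ≥0, 0 < α ∧ α < 1 ∧ ∀ i j : Fin d,
    ContDiffOn ℝ 3 (fun x => hbar x i j) (closedBall (0 : Pt d) 1) ∧
    ∃ C : ℝ≥0, HolderOnWith C α
      (iteratedFDerivWithin ℝ 3 (fun x => hbar x i j) (closedBall (0 : Pt d) 1))
      (closedBall (0 : Pt d) 1)

/-- `h` is an `η`-admissible Einstein metric on the open unit ball of `ℝ^(n+1)`. -/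
structure IsAdmissibleEinstein (n : ℕ) (η : ℝ) (h : TensorField (n + 1)) : Prop where
  /-- `h` is `C^{3,α}` conformally compact (with boundary defining function `1 - |x|²`), and the
  Yamabe invariant of its conformal infinity is positive. -/
  conformallyCompact : ∃ hbar : TensorField (n + 1),
    (∀ x ∈ ball (0 : Pt (n + 1)) 1, hbar x = (1 - ‖x‖ ^ 2) ^ 2 • h x) ∧
    IsHolderMetricOnClosedBall hbar ∧ 0 < yamabeInvariant n hbar
  /-- `Rc = -n h`. -/
  einstein : ∀ x ∈ ball (0 : Pt (n + 1)) 1, ∀ i j, ricci h i j x = -(n : ℝ) * h x i j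
  /-- `|R + R^{cc}|_h ≤ η` everywhere. -/
  curvature_le : ∀ x ∈ ball (0 : Pt (n + 1)) 1,
    Real.sqrt (normSq4 (h x) fun i j k l => curvatureError h i j k l x) ≤ η

/-! ### The normalized Ricci-DeTurck flow -/

/-- `g t`, `t ∈ I`, are Riemannian metrics on the open unit ball, of class `C^k` jointly in time
and space. -/
def IsMetricFamily {d : ℕ} (k : WithTop ℕ∞) (I : Set ℝ) (g : ℝ → TensorField d) : Prop :=
  (∀ t ∈ I, ∀ x ∈ ball (0 : Pt d) 1, (g t x).PosDef) ∧
  ∀ i j : Fin d, ContDiffOn ℝ k (fun p : ℝ × Pt d => g p.1 p.2 i j) (I ×ˢ ball (0 : Pt d) 1)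

/-- The vector field `W^k = g^{pq} (Γ(g)^k_{pq} - Γ(h)^k_{pq})`. -/
def deTurckField {d : ℕ} (h g : TensorField d) (k : Fin d) (x : Pt d) : ℝ :=
  ∑ p, ∑ q, (g x)⁻¹ p q * (christoffel g k p q x - christoffel h k p q x)

/-- The `1`-form `W_j = g_{jk} W^k`. -/
def deTurckForm {d : ℕ} (h g : TensorField d) (j : Fin d) (x : Pt d) : ℝ :=
  ∑ k, g x j k * deTurckField h g k x

/-- `g` solves the normalized Ricci-DeTurck flow with background metric `h` on the open unit ball of
`ℝ^(n+1)`, for times in `I`: `∂_t g_{ij} = -2n g_{ij} - 2 Rc(g)_{ij} + ∇_i W_j + ∇_j W_i`, where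
`∇` is the Levi-Civita connection of `g(t)`. -/
def IsNormalizedRicciDeTurckFlow (n : ℕ) (h : TensorField (n + 1)) (I : Set ℝ)
    (g : ℝ → TensorField (n + 1)) : Prop :=
  ∀ t ∈ I, ∀ x ∈ ball (0 : Pt (n + 1)) 1, ∀ i j,
    HasDerivAt (fun s => g s x i j)
      (-2 * (n : ℝ) * g t x i j - 2 * ricci (g t) i j x
        + nabla1 (g t) (deTurckForm h (g t)) i j x
        + nabla1 (g t) (deTurckForm h (g t)) j i x) t

/-- `g` is `ε`-close to `h` on the open unit ball: `(1 + ε)⁻¹ h ≤ g ≤ (1 + ε) h`. -/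
def IsEpsClose {d : ℕ} (ε : ℝ) (h g : TensorField d) : Prop :=
  ∀ x ∈ ball (0 : Pt d) 1, ∀ v : Fin d → ℝ,
    (1 + ε)⁻¹ * (v ⬝ᵥ (h x).mulVec v) ≤ v ⬝ᵥ (g x).mulVec v ∧
    v ⬝ᵥ (g x).mulVec v ≤ (1 + ε) * (v ⬝ᵥ (h x).mulVec v)

/-- The curvature error term in the evolution of `|g - h|²`: the inner product of `2 (g - h)` with
the tensor `2 g^{ab} g_{ip} h^{pq} E_{jaqb}`, that is,
`4 h^{ik} h^{jl} (g - h)_{kl} g^{ab} g_{ip} h^{pq} E_{jaqb}`. -/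
def curvatureErrorTerm {d : ℕ} (h g : TensorField d) (x : Pt d) : ℝ :=
  4 * ∑ i, ∑ j, ∑ k, ∑ l, (h x)⁻¹ i k * (h x)⁻¹ j l * (g x - h x) k l *
    ∑ a, ∑ b, ∑ p, ∑ q, (g x)⁻¹ a b * g x i p * (h x)⁻¹ p q * curvatureError h j a q b x

end

/-!
Fix a time `t` and a point `x`, write `Z = g - h`, and let `∇` be the connection of `h`. Every
covariant derivative is treated as a matrix identity: with the connection matrices
`(Γ_a)^k_i = Γ^k_{ai}` of `h`, one has `∇_a S = ∂_a S - Γ_aᵀ S - S Γ_a`.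

The DeTurck field makes the Ricci operator strictly elliptic (`IsC2Metric.ricciDeTurck_eq`). The
difference of the connections is `g⁻¹` applied to a combination of the derivatives `∇ g`
(`lowDiff`), so that the curvatures of `g` and `h` differ by second derivatives of `g` and terms
quadratic in `∇ g` (`IsC2Metric.curvM_sub`); of the second derivatives, those not of the form
`g^{ij} ∇_i ∇_j g` cancel against the DeTurck terms up to commutators, which the Ricci identity
(`IsC2Metric.cov2_sub_cov2`) turns into the curvature of `h`. The Ricci tensor of `h` drops out, and
splitting the rest as `R = E - R^{cc}` gives `IsC2Metric.flowField_eq`: the right-hand side of the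
flow is
`g^{ij} ∇_i ∇_j g + (error terms in E) + 2 ((tr (g⁻¹ h) - n) g - h) + (terms quadratic in ∇ g)`.
Pairing with `2 Z` and using `∇ h = 0` (`IsC2Metric.hess_normSq2`) gives an exact evolution equation
for `|Z|²`, `IsC2Metric.ip_flowField`.

What remains is algebra at a point. In a frame which is orthonormal for `h` and in which `g` is
diagonal with eigenvalues `λ_a ∈ [(1 + ε)⁻¹, 1 + ε]` (`exists_isFrame`), `|Z|² = ∑ z_a²` with
`z_a = λ_a - 1`, and the four terms are estimated as follows.
* The gradient term is at least `(1 - ε) |∇ Z|²` since `λ_a⁻¹ ≥ 1 - ε`.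
* The quadratic terms, paired with `Z`, are at most a multiple of `ε |∇ Z|²` since `|z_a| ≤ ε`.
* The zeroth order term, paired with `2 Z`, is `4 |Z|² - 4 (∑ z_a)²` up to `O(ε |Z|²)`.
* The error term is `4 ∑ z_c λ_c λ_e⁻¹ E_{cece}`, summed over `c` and `e`. By the Einstein
  equation the trace `∑_e E_{cece}` vanishes, so `λ_e⁻¹` may be replaced by
  `λ_e⁻¹ - 1 = O(|z_e|)`, and the term is `O(η |Z|²)`.
-/

noncomputable section

open scoped Topology

variable {d : ℕ}

/-! ### Partial derivatives of functions and of matrix fields -/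

lemma pd_congr {f g : Pt d → ℝ} {x : Pt d} (a : Fin d) (hfg : f =ᶠ[𝓝 x] g) :
    pd a f x = pd a g x := by
  unfold pd; rw [hfg.fderiv_eq]

lemma pd_add {f g : Pt d → ℝ} {x : Pt d} (a : Fin d) (hf : DifferentiableAt ℝ f x)
    (hg : DifferentiableAt ℝ g x) : pd a (fun y => f y + g y) x = pd a f x + pd a g x := by
  simp [pd, fderiv_fun_add hf hg]

lemma pd_sub {f g : Pt d → ℝ} {x : Pt d} (a : Fin d) (hf : DifferentiableAt ℝ f x)
    (hg : DifferentiableAt ℝ g x) : pd a (fun y => f y - g y) x = pd a f x - pd a g x := by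
  simp [pd, fderiv_fun_sub hf hg]

lemma pd_mul {f g : Pt d → ℝ} {x : Pt d} (a : Fin d) (hf : DifferentiableAt ℝ f x)
    (hg : DifferentiableAt ℝ g x) :
    pd a (fun y => f y * g y) x = pd a f x * g x + f x * pd a g x := by
  simp [pd, fderiv_fun_mul hf hg]; ring

lemma pd_const_mul {f : Pt d → ℝ} {x : Pt d} (a : Fin d) (c : ℝ)
    (hf : DifferentiableAt ℝ f x) : pd a (fun y => c * f y) x = c * pd a f x := by
  simp [pd, fderiv_const_mul hf]

lemma pd_const {x : Pt d} (a : Fin d) (c : ℝ) : pd a (fun _ => c) x = 0 := by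
  simp [pd]

lemma pd_sum {ι : Type*} [Fintype ι] {f : ι → Pt d → ℝ} {x : Pt d} (a : Fin d)
    (hf : ∀ i, DifferentiableAt ℝ (f i) x) :
    pd a (fun y => ∑ i, f i y) x = ∑ i, pd a (f i) x := by
  simp [pd, fderiv_fun_sum fun i _ => hf i]

lemma ContDiffAt.pd {f : Pt d → ℝ} {x : Pt d} {m n : WithTop ℕ∞} (hf : ContDiffAt ℝ n f x)
    (hmn : m + 1 ≤ n) (a : Fin d) : ContDiffAt ℝ m (fun y => pd a f y) x :=
  (hf.fderiv_right hmn).clm_apply contDiffAt_const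

/-- Partial derivatives of a `C²` function commute. -/
lemma pd_comm {f : Pt d → ℝ} {x : Pt d} (hf : ContDiffAt ℝ 2 f x) (a b : Fin d) :
    pd a (fun y => pd b f y) x = pd b (fun y => pd a f y) x := by
  have hd : DifferentiableAt ℝ (fderiv ℝ f) x :=
    (hf.fderiv_right (m := 1) (by norm_num)).differentiableAt (by norm_num)
  have key : ∀ a b : Fin d, pd a (fun y => pd b f y) x
      = fderiv ℝ (fderiv ℝ f) x (EuclideanSpace.single a 1) (EuclideanSpace.single b 1) := by
    intro a b
    unfold pd
    rw [fderiv_clm_apply hd (differentiableAt_const _)]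
    simp
  rw [key, key]
  exact hf.isSymmSndFDerivAt (by simp) _ _

/-- The matrix of the partial derivatives `∂_a S_{ij}`. -/
def pdM (a : Fin d) (S : TensorField d) : TensorField d :=
  fun x => Matrix.of fun i j => pd a (fun y => S y i j) x

/-- All entries of `S` are differentiable at `x`. -/
def MDiffAt (S : TensorField d) (x : Pt d) : Prop :=
  ∀ i j, DifferentiableAt ℝ (fun y => S y i j) x

lemma MDiffAt.mul {S T : TensorField d} {x : Pt d} (hS : MDiffAt S x) (hT : MDiffAt T x) :
    MDiffAt (fun y => S y * T y) x := fun i j => by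
  simp only [Matrix.mul_apply]
  exact DifferentiableAt.fun_sum fun k _ => (hS i k).fun_mul (hT k j)

lemma MDiffAt.sub {S T : TensorField d} {x : Pt d} (hS : MDiffAt S x) (hT : MDiffAt T x) :
    MDiffAt (fun y => S y - T y) x := fun i j => (hS i j).sub (hT i j)

lemma MDiffAt.transpose {S : TensorField d} {x : Pt d} (hS : MDiffAt S x) :
    MDiffAt (fun y => (S y).transpose) x := fun i j => hS j i

lemma pdM_mul {S T : TensorField d} {x : Pt d} (a : Fin d) (hS : MDiffAt S x)
    (hT : MDiffAt T x) :
    pdM a (fun y => S y * T y) x = pdM a S x * T x + S x * pdM a T x := by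
  ext i j
  simp only [pdM, Matrix.of_apply, Matrix.add_apply, Matrix.mul_apply]
  rw [pd_sum a fun k => (hS i k).fun_mul (hT k j), ← Finset.sum_add_distrib]
  exact Finset.sum_congr rfl fun k _ => pd_mul a (hS i k) (hT k j)

lemma pdM_add {S T : TensorField d} {x : Pt d} (a : Fin d) (hS : MDiffAt S x)
    (hT : MDiffAt T x) : pdM a (fun y => S y + T y) x = pdM a S x + pdM a T x := by
  ext i j; exact pd_add a (hS i j) (hT i j)

lemma pdM_sub {S T : TensorField d} {x : Pt d} (a : Fin d) (hS : MDiffAt S x)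
    (hT : MDiffAt T x) : pdM a (fun y => S y - T y) x = pdM a S x - pdM a T x := by
  ext i j; exact pd_sub a (hS i j) (hT i j)

lemma pdM_transpose (S : TensorField d) (x : Pt d) (a : Fin d) :
    pdM a (fun y => (S y).transpose) x = (pdM a S x).transpose := rfl

lemma pdM_congr {S T : TensorField d} {x : Pt d} (a : Fin d) (h : S =ᶠ[𝓝 x] T) :
    pdM a S x = pdM a T x := by
  ext i j
  exact pd_congr a (h.mono fun y hy => by simp [hy])

lemma pd_trace {S : TensorField d} {x : Pt d} (a : Fin d) (hS : MDiffAt S x) :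
    pd a (fun y => (S y).trace) x = (pdM a S x).trace := by
  simp only [Matrix.trace, Matrix.diag, pdM, Matrix.of_apply]
  exact pd_sum a fun i => hS i i

lemma contDiffAt_det {S : TensorField d} {x : Pt d} {n : WithTop ℕ∞}
    (hS : ∀ i j, ContDiffAt ℝ n (fun y => S y i j) x) :
    ContDiffAt ℝ n (fun y => (S y).det) x := by
  simp only [Matrix.det_apply']
  exact ContDiffAt.sum fun σ _ => contDiffAt_const.mul (contDiffAt_prod fun i _ => hS _ _)

lemma contDiffAt_inv_apply {S : TensorField d} {x : Pt d} {n : WithTop ℕ∞}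
    (hS : ∀ i j, ContDiffAt ℝ n (fun y => S y i j) x) (hdet : (S x).det ≠ 0) (i j : Fin d) :
    ContDiffAt ℝ n (fun y => (S y)⁻¹ i j) x := by
  simp only [Matrix.inv_def, Ring.inverse_eq_inv', Matrix.smul_apply, smul_eq_mul,
    Matrix.adjugate_apply]
  refine (ContDiffAt.inv (contDiffAt_det hS) hdet).mul (contDiffAt_det fun k l => ?_)
  by_cases hk : k = j
  · subst hk; simpa using contDiffAt_const
  · simpa [Matrix.updateRow_ne hk] using hS k l

/-! ### Metrics of class `C²` and their Levi-Civita connection -/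

/-- `g` is a Riemannian metric of class `C²` on the set `U`. -/
structure IsC2Metric (U : Set (Pt d)) (g : TensorField d) : Prop where
  isOpen : IsOpen U
  posDef : ∀ x ∈ U, (g x).PosDef
  contDiffAt : ∀ x ∈ U, ∀ i j, ContDiffAt ℝ 2 (fun y => g y i j) x

variable {U : Set (Pt d)} {g h : TensorField d} {x : Pt d}

namespace IsC2Metric

lemma symm (hg : IsC2Metric U g) (hx : x ∈ U) (i j : Fin d) : g x i j = g x j i := by
  simpa using ((hg.posDef x hx).isHermitian.apply j i)

lemma transpose (hg : IsC2Metric U g) (hx : x ∈ U) : (g x).transpose = g x := by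
  ext i j; exact hg.symm hx j i

lemma det_ne_zero (hg : IsC2Metric U g) (hx : x ∈ U) : (g x).det ≠ 0 :=
  (hg.posDef x hx).det_pos.ne'

lemma mul_inv (hg : IsC2Metric U g) (hx : x ∈ U) : g x * (g x)⁻¹ = 1 :=
  Matrix.mul_nonsing_inv _ (isUnit_iff_ne_zero.mpr (hg.det_ne_zero hx))

lemma inv_mul (hg : IsC2Metric U g) (hx : x ∈ U) : (g x)⁻¹ * g x = 1 :=
  Matrix.nonsing_inv_mul _ (isUnit_iff_ne_zero.mpr (hg.det_ne_zero hx))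

lemma inv_transpose (hg : IsC2Metric U g) (hx : x ∈ U) : ((g x)⁻¹).transpose = (g x)⁻¹ := by
  rw [Matrix.transpose_nonsing_inv, hg.transpose hx]

lemma inv_symm (hg : IsC2Metric U g) (hx : x ∈ U) (i j : Fin d) :
    (g x)⁻¹ i j = (g x)⁻¹ j i := by
  conv_lhs => rw [← hg.inv_transpose hx]
  rfl

lemma eventually (hg : IsC2Metric U g) (hx : x ∈ U) : ∀ᶠ y in 𝓝 x, y ∈ U :=
  hg.isOpen.mem_nhds hx

lemma mdiffAt (hg : IsC2Metric U g) (hx : x ∈ U) : MDiffAt g x := fun i j =>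
  (hg.contDiffAt x hx i j).differentiableAt (by norm_num)

lemma contDiffAt_inv (hg : IsC2Metric U g) (hx : x ∈ U) (i j : Fin d) :
    ContDiffAt ℝ 2 (fun y => (g y)⁻¹ i j) x :=
  contDiffAt_inv_apply (hg.contDiffAt x hx) (hg.det_ne_zero hx) i j

lemma mdiffAt_inv (hg : IsC2Metric U g) (hx : x ∈ U) : MDiffAt (fun y => (g y)⁻¹) x :=
  fun i j => (hg.contDiffAt_inv hx i j).differentiableAt (by norm_num)

lemma pd_symm (hg : IsC2Metric U g) (hx : x ∈ U) (a i j : Fin d) :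
    pd a (fun y => g y i j) x = pd a (fun y => g y j i) x :=
  pd_congr a ((hg.eventually hx).mono fun _ hy => hg.symm hy i j)

lemma pdM_inv (hg : IsC2Metric U g) (hx : x ∈ U) (a : Fin d) :
    pdM a (fun y => (g y)⁻¹) x = -((g x)⁻¹ * pdM a g x * (g x)⁻¹) := by
  have h1 : pdM a (fun y => (g y)⁻¹ * g y) x = 0 := by
    rw [pdM_congr (T := fun _ => 1) a ((hg.eventually hx).mono fun y hy => hg.inv_mul hy)]
    ext i j; exact pd_const a _
  rw [pdM_mul a (hg.mdiffAt_inv hx) (hg.mdiffAt hx)] at h1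
  have h2 := congrArg (· * (g x)⁻¹) (eq_neg_of_add_eq_zero_left h1)
  simpa [Matrix.mul_assoc, hg.mul_inv hx] using h2

lemma contDiffAt_christoffel (hg : IsC2Metric U g) (hx : x ∈ U) (k i j : Fin d) :
    ContDiffAt ℝ 1 (fun y => christoffel g k i j y) x := by
  unfold christoffel
  have hp : ∀ a i j, ContDiffAt ℝ 1 (fun y => pd a (fun z => g z i j) y) x := fun a i j =>
    (hg.contDiffAt x hx i j).pd (by norm_num) a
  exact contDiffAt_const.mul (ContDiffAt.sum fun l _ =>
    ((hg.contDiffAt_inv hx k l).of_le (by norm_num)).mul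
      (((hp _ _ _).add (hp _ _ _)).sub (hp _ _ _)))

lemma christoffel_symm (hg : IsC2Metric U g) (hx : x ∈ U) (k i j : Fin d) :
    christoffel g k i j x = christoffel g k j i x := by
  unfold christoffel
  congr 1
  refine Finset.sum_congr rfl fun l _ => ?_
  rw [hg.pd_symm hx l i j]; ring

/-- The Christoffel symbols with the upper index lowered. -/
lemma sum_mul_christoffel (hg : IsC2Metric U g) (hx : x ∈ U) (m i j : Fin d) :
    ∑ k, g x m k * christoffel g k i j x = (1 / 2) * (pd i (fun y => g y j m) x
      + pd j (fun y => g y i m) x - pd m (fun y => g y i j) x) := by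
  have h1 : ∀ l, ∑ k, g x m k * (g x)⁻¹ k l = if m = l then 1 else 0 := fun l => by
    rw [← Matrix.mul_apply, hg.mul_inv hx, Matrix.one_apply]
  unfold christoffel
  simp only [Finset.mul_sum]
  rw [Finset.sum_comm]
  have : ∀ l, ∑ k, g x m k * (1 / 2 * ((g x)⁻¹ k l * (pd i (fun y => g y j l) x
      + pd j (fun y => g y i l) x - pd l (fun y => g y i j) x)))
      = (∑ k, g x m k * (g x)⁻¹ k l) * (1 / 2 * (pd i (fun y => g y j l) x
      + pd j (fun y => g y i l) x - pd l (fun y => g y i j) x)) := fun l => by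
    rw [Finset.sum_mul]; exact Finset.sum_congr rfl fun k _ => by ring
  simp only [this, h1, ite_mul, one_mul, zero_mul, Finset.sum_ite_eq, Finset.mem_univ, if_true]

end IsC2Metric

/-- The connection matrix `(Γ_a)^k_i = Γ^k_{ai}` in the direction `∂_a`. -/
def conn (h : TensorField d) (a : Fin d) : TensorField d :=
  fun x => Matrix.of fun k i => christoffel h k a i x

/-- The covariant derivative `∇_a S` of a `2`-tensor, as a matrix; when `S` carries further
indices, they are not differentiated covariantly. -/
def cov (h : TensorField d) (a : Fin d) (S : TensorField d) : TensorField d :=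
  fun x => pdM a S x - (conn h a x).transpose * S x - S x * conn h a x

/-- The second covariant derivative `∇_a ∇_b S` of a `2`-tensor, as a matrix. -/
def cov2 (h : TensorField d) (S : TensorField d) (a b : Fin d) : TensorField d :=
  fun x => cov h a (cov h b S) x - ∑ m, christoffel h m a b x • cov h m S x

lemma cov_apply (h S : TensorField d) (a i j : Fin d) (x : Pt d) :
    cov h a S x i j = nabla2 h S a i j x := by
  simp only [cov, nabla2, Matrix.sub_apply, Matrix.mul_apply, pdM, conn, Matrix.of_apply,
    Matrix.transpose_apply, Finset.sum_add_distrib]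
  rw [sub_sub]
  congr 2
  exact Finset.sum_congr rfl fun m _ => mul_comm _ _

lemma pdM_eq_cov (h S : TensorField d) (a : Fin d) (x : Pt d) :
    pdM a S x = cov h a S x + (conn h a x).transpose * S x + S x * conn h a x := by
  unfold cov; abel

namespace IsC2Metric

lemma mdiffAt_conn (hh : IsC2Metric U h) (hx : x ∈ U) (a : Fin d) : MDiffAt (conn h a) x :=
  fun k i => (hh.contDiffAt_christoffel hx k a i).differentiableAt (by norm_num)

lemma mdiffAt_cov (hh : IsC2Metric U h) (hx : x ∈ U) {S : TensorField d}
    (hS : ∀ i j, ContDiffAt ℝ 2 (fun y => S y i j) x) (a : Fin d) : MDiffAt (cov h a S) x := by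
  have hS' : MDiffAt S x := fun i j => (hS i j).differentiableAt (by norm_num)
  have hp : MDiffAt (pdM a S) x := fun i j =>
    ((hS i j).pd (m := 1) (by norm_num) a).differentiableAt (by norm_num)
  exact (hp.sub ((hh.mdiffAt_conn hx a).transpose.mul hS')).sub (hS'.mul (hh.mdiffAt_conn hx a))

/-- Metric compatibility of the Levi-Civita connection. -/
lemma cov_self (hh : IsC2Metric U h) (hx : x ∈ U) (a : Fin d) : cov h a h x = 0 := by
  have key : ∀ i j, (h x * conn h a x) i j = (1 / 2) * (pd a (fun y => h y j i) x
      + pd j (fun y => h y a i) x - pd i (fun y => h y a j) x) := fun i j =>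
    hh.sum_mul_christoffel hx i a j
  have key2 : (conn h a x).transpose * h x = (h x * conn h a x).transpose := by
    rw [Matrix.transpose_mul, hh.transpose hx]
  ext i j
  simp only [cov, Matrix.sub_apply, key2, Matrix.transpose_apply, key, pdM, Matrix.of_apply,
    Matrix.zero_apply]
  rw [hh.pd_symm hx a j i]
  ring

/-- The derivative of `g⁻¹` in terms of the covariant derivative of `g` for another connection. -/
lemma pdM_inv_eq (hg : IsC2Metric U g) (hx : x ∈ U) (h : TensorField d) (a : Fin d) :
    pdM a (fun y => (g y)⁻¹) x = -((g x)⁻¹ * cov h a g x * (g x)⁻¹)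
      - (g x)⁻¹ * (conn h a x).transpose - conn h a x * (g x)⁻¹ := by
  rw [hg.pdM_inv hx, pdM_eq_cov h]
  simp only [Matrix.mul_add, Matrix.add_mul]
  have h1 : (g x)⁻¹ * ((conn h a x).transpose * g x) * (g x)⁻¹
      = (g x)⁻¹ * (conn h a x).transpose := by
    rw [Matrix.mul_assoc, Matrix.mul_assoc, hg.mul_inv hx, Matrix.mul_one]
  have h2 : (g x)⁻¹ * (g x * conn h a x) * (g x)⁻¹ = conn h a x * (g x)⁻¹ := by
    rw [← Matrix.mul_assoc, hg.inv_mul hx, Matrix.one_mul]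
  rw [h1, h2]; abel

end IsC2Metric

end

noncomputable section

variable {d : ℕ} {U : Set (Pt d)} {g h : TensorField d} {x : Pt d}

/-! ### The Hessian of the squared norm of a tensor field -/

/-- The inner product of two covariant `2`-tensors for the inverse metric `K`. -/
def ip (K A B : Matrix (Fin d) (Fin d) ℝ) : ℝ :=
  ∑ i, ∑ j, ∑ i', ∑ j', K i i' * K j j' * A i j * B i' j'

lemma normSq2_eq_ip (q A : Matrix (Fin d) (Fin d) ℝ) : normSq2 q A = ip q⁻¹ A A := rfl

lemma ip_eq_trace (K A B : Matrix (Fin d) (Fin d) ℝ) :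
    ip K A B = (K * (B * (K.transpose * A.transpose))).trace := by
  simp only [ip, Matrix.trace, Matrix.diag, Matrix.mul_apply, Matrix.transpose_apply,
    Finset.mul_sum]
  refine Finset.sum_congr rfl fun i _ => ?_
  rw [Finset.sum_comm]
  refine Finset.sum_congr rfl fun i' _ => ?_
  rw [Finset.sum_comm]
  refine Finset.sum_congr rfl fun j' _ => Finset.sum_congr rfl fun j _ => by ring

lemma ip_comm {K : Matrix (Fin d) (Fin d) ℝ} (hK : K.transpose = K)
    (A B : Matrix (Fin d) (Fin d) ℝ) : ip K A B = ip K B A := by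
  rw [ip_eq_trace, ip_eq_trace, ← Matrix.trace_transpose]
  simp only [Matrix.transpose_mul, Matrix.transpose_transpose, hK]
  rw [Matrix.trace_mul_comm]
  simp only [Matrix.mul_assoc]

lemma ip_add_right (K A B C : Matrix (Fin d) (Fin d) ℝ) :
    ip K A (B + C) = ip K A B + ip K A C := by
  simp only [ip_eq_trace, Matrix.add_mul, Matrix.mul_add, Matrix.trace_add]

lemma ip_sub_left (K A B C : Matrix (Fin d) (Fin d) ℝ) :
    ip K (A - B) C = ip K A C - ip K B C := by
  simp only [ip_eq_trace, Matrix.transpose_sub, Matrix.mul_sub, Matrix.trace_sub]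

lemma ip_smul_left (K A C : Matrix (Fin d) (Fin d) ℝ) (c : ℝ) :
    ip K (c • A) C = c * ip K A C := by
  simp [ip_eq_trace]

lemma ip_sum_left {ι : Type*} [Fintype ι] (K C : Matrix (Fin d) (Fin d) ℝ)
    (A : ι → Matrix (Fin d) (Fin d) ℝ) :
    ip K (∑ m, A m) C = ∑ m, ip K (A m) C := by
  simp only [ip_eq_trace, Matrix.transpose_sum, Matrix.mul_sum, Matrix.trace_sum]

/-- The Leibniz rule for the inner product of two tensor fields; the derivatives of `h⁻¹` are
absorbed by `∇ h = 0`. -/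
lemma IsC2Metric.pd_ip (hh : IsC2Metric U h) (hx : x ∈ U) {S T : TensorField d}
    (hS : MDiffAt S x) (hT : MDiffAt T x) (a : Fin d) :
    pd a (fun y => ip (h y)⁻¹ (S y) (T y)) x
      = ip (h x)⁻¹ (cov h a S x) (T x) + ip (h x)⁻¹ (S x) (cov h a T x) := by
  have hK := hh.mdiffAt_inv hx
  have hKt : (pdM a (fun y => (h y)⁻¹) x).transpose = pdM a (fun y => (h y)⁻¹) x := by
    rw [← pdM_transpose]
    exact pdM_congr a ((hh.eventually hx).mono fun y hy => hh.inv_transpose hy)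
  have hpK := hh.pdM_inv_eq hx h a
  rw [hh.cov_self hx] at hpK
  simp only [ip_eq_trace]
  rw [pd_trace a (hK.mul (hT.mul (hK.transpose.mul hS.transpose))),
    pdM_mul a hK (hT.mul (hK.transpose.mul hS.transpose)),
    pdM_mul a hT (hK.transpose.mul hS.transpose), pdM_mul a hK.transpose hS.transpose,
    pdM_transpose, pdM_transpose, hKt, hh.inv_transpose hx, hpK, pdM_eq_cov h T, pdM_eq_cov h S]
  simp only [Matrix.transpose_add, Matrix.transpose_mul, Matrix.transpose_transpose]
  set K := (h x)⁻¹
  set Γ := conn h a x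
  set A := S x
  set B := T x
  set A' := cov h a S x
  set B' := cov h a T x
  have h1 : (-(K * 0 * K) - K * Γ.transpose - Γ * K) * (B * (K * A.transpose))
      + K * ((B' + Γ.transpose * B + B * Γ) * (K * A.transpose)
        + B * ((-(K * 0 * K) - K * Γ.transpose - Γ * K) * A.transpose
          + K * (A'.transpose + A.transpose * Γ + Γ.transpose * A.transpose)))
      = K * (B * (K * A'.transpose)) + K * (B' * (K * A.transpose))
        + ((K * (B * (K * A.transpose))) * Γ - Γ * (K * (B * (K * A.transpose)))) := by
    noncomm_ring
  rw [h1, Matrix.trace_add, Matrix.trace_add, Matrix.trace_sub,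
    Matrix.trace_mul_comm _ Γ, sub_self, add_zero]

/-- `∇_a ∇_b |Z|² = 2 ⟨∇_a ∇_b Z, Z⟩ + 2 ⟨∇_a Z, ∇_b Z⟩`. -/
lemma IsC2Metric.hess_normSq2 (hh : IsC2Metric U h) (hx : x ∈ U) {Z : TensorField d}
    (hZ : ∀ y ∈ U, ∀ i j, ContDiffAt ℝ 2 (fun y => Z y i j) y) (a b : Fin d) :
    hess h (fun y => normSq2 (h y) (Z y)) a b x
      = 2 * ip (h x)⁻¹ (cov2 h Z a b x) (Z x)
        + 2 * ip (h x)⁻¹ (cov h a Z x) (cov h b Z x) := by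
  have hZd : ∀ y ∈ U, MDiffAt Z y := fun y hy i j =>
    (hZ y hy i j).differentiableAt (by norm_num)
  have h1 : ∀ b, ∀ y ∈ U, pd b (fun y => normSq2 (h y) (Z y)) y
      = 2 * ip (h y)⁻¹ (cov h b Z y) (Z y) := fun b y hy => by
    simp only [normSq2_eq_ip]
    rw [hh.pd_ip hy (hZd y hy) (hZd y hy), ip_comm (hh.inv_transpose hy) (Z y)]
    ring
  have hcov := hh.mdiffAt_cov hx (hZ x hx) b
  have hK := hh.mdiffAt_inv hx
  have hd : DifferentiableAt ℝ (fun y => ip (h y)⁻¹ (cov h b Z y) (Z y)) x := by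
    unfold ip
    exact DifferentiableAt.fun_sum fun i _ => DifferentiableAt.fun_sum fun j _ =>
      DifferentiableAt.fun_sum fun i' _ => DifferentiableAt.fun_sum fun j' _ =>
      (((hK i i').fun_mul (hK j j')).fun_mul (hcov i j)).fun_mul (hZd x hx i' j')
  unfold hess nabla1
  rw [pd_congr a ((hh.eventually hx).mono (h1 b)), pd_const_mul a 2 hd,
    hh.pd_ip hx hcov (hZd x hx), cov2, ip_sub_left, ip_sum_left,
    ip_comm (hh.inv_transpose hx) (cov h b Z x)]
  simp only [h1 _ x hx, ip_smul_left, Finset.mul_sum, mul_sub, mul_add]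
  have : ∀ m, christoffel h m a b x * (2 * ip (h x)⁻¹ (cov h m Z x) (Z x))
      = 2 * (christoffel h m a b x * ip (h x)⁻¹ (cov h m Z x) (Z x)) := fun m => by ring
  simp only [this]
  ring

/-! ### The Ricci identity -/

/-- The curvature as an endomorphism, `(R_{ab})^l_k = R_{abk}^l`. -/
def curvM (g : TensorField d) (a b : Fin d) : TensorField d :=
  fun x => Matrix.of fun l k => riemannUp g a b k l x

lemma curvM_eq (g : TensorField d) (a b : Fin d) (x : Pt d) :
    curvM g a b x = pdM a (conn g b) x - pdM b (conn g a) x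
      + (conn g a x * conn g b x - conn g b x * conn g a x) := by
  ext l k
  simp [curvM, riemannUp, pdM, conn, Matrix.mul_apply, Finset.sum_sub_distrib]

/-- The commutator of covariant derivatives of a `2`-tensor. -/
lemma IsC2Metric.cov2_sub_cov2 (hh : IsC2Metric U h) (hx : x ∈ U) {S : TensorField d}
    (hS : ∀ i j, ContDiffAt ℝ 2 (fun y => S y i j) x) (a b : Fin d) :
    cov2 h S a b x - cov2 h S b a x
      = -((curvM h a b x).transpose * S x) - S x * curvM h a b x := by
  have hSd : MDiffAt S x := fun i j => (hS i j).differentiableAt (by norm_num)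
  have hp : ∀ a, MDiffAt (pdM a S) x := fun a i j =>
    ((hS i j).pd (m := 1) (by norm_num) a).differentiableAt (by norm_num)
  have hΓ := fun a => hh.mdiffAt_conn hx a
  have hpp : pdM a (pdM b S) x = pdM b (pdM a S) x := by
    ext i j; exact pd_comm (hS i j) a b
  have hcc : ∀ a b, pdM a (cov h b S) x = pdM a (pdM b S) x
      - ((pdM a (conn h b) x).transpose * S x + (conn h b x).transpose * pdM a S x)
      - (pdM a S x * conn h b x + S x * pdM a (conn h b) x) := fun a b => by
    have : cov h b S = fun y => pdM b S y - (conn h b y).transpose * S y - S y * conn h b y := rfl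
    rw [this, pdM_sub a ((hp b).sub ((hΓ b).transpose.mul hSd)) (hSd.mul (hΓ b)),
      pdM_sub a (hp b) ((hΓ b).transpose.mul hSd), pdM_mul a (hΓ b).transpose hSd,
      pdM_mul a hSd (hΓ b), pdM_transpose]
  have hsum : ∑ m, christoffel h m a b x • cov h m S x
      = ∑ m, christoffel h m b a x • cov h m S x :=
    Finset.sum_congr rfl fun m _ => by rw [hh.christoffel_symm hx]
  have hexp : ∀ a b, cov h a (cov h b S) x = pdM a (cov h b S) x
      - (conn h a x).transpose * cov h b S x - cov h b S x * conn h a x := fun _ _ => rfl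
  unfold cov2
  rw [hsum, sub_sub_sub_cancel_right, hexp, hexp, hcc, hcc, hpp, curvM_eq]
  unfold cov
  simp only [Matrix.transpose_add, Matrix.transpose_sub, Matrix.transpose_mul]
  noncomm_ring

end

noncomputable section

variable {d : ℕ} {U : Set (Pt d)} {g h : TensorField d} {x : Pt d}

/-! ### Comparison of the curvatures of two metrics -/

/-- For `X_{aij} = ∇_a g_{ij}`, with `∇` the connection of `h`, this is the difference
`Γ(g) - Γ(h)` with the upper index lowered by `g` to the first slot. -/
def lowDiff (X : Fin d → Matrix (Fin d) (Fin d) ℝ) (m j k : Fin d) : ℝ :=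
  (1 / 2) * (X j k m + X k j m - X m j k)

/-- The matrix with entries `lowDiff m b k`, as a field. -/
def lowDiffM (h g : TensorField d) (b : Fin d) : TensorField d :=
  fun x => Matrix.of fun m k => lowDiff (fun a => cov h a g x) m b k

lemma IsC2Metric.mul_conn_sub (hg : IsC2Metric U g) (hh : IsC2Metric U h) (hx : x ∈ U)
    (b : Fin d) : g x * conn g b x - g x * conn h b x = lowDiffM h g b x := by
  ext m k
  have h1 : (g x * conn g b x) m k = _ := hg.sum_mul_christoffel hx m b k
  have h2 : (g x * conn h b x) m k = ∑ p, g x m p * christoffel h p b k x := rfl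
  rw [Matrix.sub_apply, h1, h2]
  simp only [lowDiffM, lowDiff, Matrix.of_apply, cov_apply, nabla2]
  have h3 : (∑ p, (christoffel h p b k x * g x p m + christoffel h p b m x * g x k p))
      + (∑ p, (christoffel h p k b x * g x p m + christoffel h p k m x * g x b p))
      - (∑ p, (christoffel h p m b x * g x p k + christoffel h p m k x * g x b p))
      = 2 * ∑ p, g x m p * christoffel h p b k x := by
    rw [← Finset.sum_add_distrib, ← Finset.sum_sub_distrib, Finset.mul_sum]
    refine Finset.sum_congr rfl fun p _ => ?_
    rw [hh.christoffel_symm hx p k b, hh.christoffel_symm hx p m b,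
      hh.christoffel_symm hx p m k, hg.symm hx p m, hg.symm hx p k]
    ring
  linarith

lemma IsC2Metric.conn_eq (hg : IsC2Metric U g) (hh : IsC2Metric U h) (hx : x ∈ U)
    (b : Fin d) : conn g b x = conn h b x + (g x)⁻¹ * lowDiffM h g b x := by
  rw [← hg.mul_conn_sub hh hx, Matrix.mul_sub, ← Matrix.mul_assoc, ← Matrix.mul_assoc,
    hg.inv_mul hx]
  simp

lemma IsC2Metric.cov_symm (hg : IsC2Metric U g) (hx : x ∈ U) (a i j : Fin d) :
    cov h a g x i j = cov h a g x j i := by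
  simp only [cov_apply, nabla2]
  rw [hg.pd_symm hx a i j]
  congr 1
  refine Finset.sum_congr rfl fun m _ => ?_
  rw [hg.symm hx m j, hg.symm hx i m]; ring

lemma cov2_apply (h S : TensorField d) (a b i j : Fin d) (x : Pt d) :
    cov2 h S a b x i j = pd a (fun y => cov h b S y i j) x
      - ∑ m, (christoffel h m a i x * cov h b S x m j + christoffel h m a j x * cov h b S x i m)
      - ∑ m, christoffel h m a b x * cov h m S x i j := by
  simp only [cov2, Matrix.sub_apply, cov_apply h (cov h b S), nabla2, Matrix.sum_apply,
    Matrix.smul_apply, smul_eq_mul]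

lemma IsC2Metric.cov2_symm (hg : IsC2Metric U g) (hx : x ∈ U) (a b i j : Fin d) :
    cov2 h g a b x i j = cov2 h g a b x j i := by
  simp only [cov2_apply]
  rw [pd_congr a ((hg.eventually hx).mono fun y hy => hg.cov_symm (h := h) hy b i j)]
  simp only [hg.cov_symm hx b i, hg.cov_symm hx _ i j, hg.cov_symm hx b _ j, add_comm]

/-- The covariant derivative of the lowered difference of the connections. -/
lemma IsC2Metric.pd_lowDiff (hg : IsC2Metric U g) (hh : IsC2Metric U h) (hx : x ∈ U)
    (a m j k : Fin d) :
    pd a (fun y => lowDiff (fun a => cov h a g y) m j k) x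
      - ∑ p, (christoffel h p a m x * lowDiff (fun a => cov h a g x) p j k
        + christoffel h p a j x * lowDiff (fun a => cov h a g x) m p k
        + christoffel h p a k x * lowDiff (fun a => cov h a g x) m j p)
      = lowDiff (fun b => cov2 h g a b x) m j k := by
  have hX := fun b => hh.mdiffAt_cov hx (hg.contDiffAt x hx) b
  simp only [lowDiff]
  rw [pd_const_mul a _ (((hX j k m).fun_add (hX k j m)).fun_sub (hX m j k)),
    pd_sub a ((hX j k m).fun_add (hX k j m)) (hX m j k), pd_add a (hX j k m) (hX k j m)]
  simp only [cov2_apply]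
  set D1 := pd a (fun y => cov h j g y k m) x
  set D2 := pd a (fun y => cov h k g y j m) x
  set D3 := pd a (fun y => cov h m g y j k) x
  simp only [Finset.sum_add_distrib, Finset.sum_sub_distrib, mul_add, mul_sub, Finset.mul_sum]
  have e : ∀ (c : Fin d → ℝ) (f : Fin d → ℝ), ∑ p, c p * (1 / 2 * f p)
      = ∑ p, 1 / 2 * (c p * f p) := fun c f => Finset.sum_congr rfl fun p _ => by ring
  simp only [e]
  ring

lemma IsC2Metric.mdiffAt_lowDiffM (hg : IsC2Metric U g) (hh : IsC2Metric U h) (hx : x ∈ U)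
    (b : Fin d) : MDiffAt (lowDiffM h g b) x := fun m k => by
  have hX := fun b => hh.mdiffAt_cov hx (hg.contDiffAt x hx) b
  exact (((hX b k m).fun_add (hX k b m)).fun_sub (hX m b k)).const_mul _

/-- The curvatures of two metrics differ by first derivatives and by the commutator of the
difference of the connections. -/
lemma IsC2Metric.curvM_sub (hg : IsC2Metric U g) (hh : IsC2Metric U h) (hx : x ∈ U)
    (a b : Fin d) :
    curvM g a b x = curvM h a b x
      + (g x)⁻¹ * (cov h a (lowDiffM h g b) x - cov h b (lowDiffM h g a) x)
      - (g x)⁻¹ * (cov h a g x * ((g x)⁻¹ * lowDiffM h g b x))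
      + (g x)⁻¹ * (cov h b g x * ((g x)⁻¹ * lowDiffM h g a x))
      + (g x)⁻¹ * (lowDiffM h g a x * ((g x)⁻¹ * lowDiffM h g b x))
      - (g x)⁻¹ * (lowDiffM h g b x * ((g x)⁻¹ * lowDiffM h g a x)) := by
  have hp : ∀ a b, pdM a (conn g b) x = pdM a (conn h b) x
      + (pdM a (fun y => (g y)⁻¹) x * lowDiffM h g b x
        + (g x)⁻¹ * pdM a (lowDiffM h g b) x) := fun a b => by
    rw [pdM_congr a ((hg.eventually hx).mono fun y hy => hg.conn_eq hh hy b),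
      pdM_add a (hh.mdiffAt_conn hx b)
        ((hg.mdiffAt_inv hx).mul (hg.mdiffAt_lowDiffM hh hx b)),
      pdM_mul a (hg.mdiffAt_inv hx) (hg.mdiffAt_lowDiffM hh hx b)]
  rw [curvM_eq, curvM_eq, hp, hp, hg.conn_eq hh hx, hg.conn_eq hh hx,
    hg.pdM_inv_eq hx h, hg.pdM_inv_eq hx h, pdM_eq_cov h (lowDiffM h g a),
    pdM_eq_cov h (lowDiffM h g b)]
  noncomm_ring

lemma riemannUp_antisymm (h : TensorField d) (a b k l : Fin d) (x : Pt d) :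
    riemannUp h a b k l x = -riemannUp h b a k l x := by
  simp only [riemannUp, Finset.sum_sub_distrib]; ring

/-- The trace of the first Bianchi identity. -/
lemma IsC2Metric.trace_curvM (hh : IsC2Metric U h) (hx : x ∈ U) (j k : Fin d) :
    (curvM h j k x).trace = ricci h k j x - ricci h j k x := by
  have hpd : ∀ a l i j, pd a (christoffel h l i j) x = pd a (christoffel h l j i) x :=
    fun a l i j => pd_congr a ((hh.eventually hx).mono fun y hy => hh.christoffel_symm hy l i j)
  simp only [Matrix.trace, Matrix.diag, curvM, Matrix.of_apply, ricci]
  rw [← Finset.sum_sub_distrib]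
  refine Finset.sum_congr rfl fun i _ => ?_
  simp only [riemannUp, Finset.sum_sub_distrib]
  rw [hpd j i k i, hpd k i j i, hpd i i k j]
  simp only [hh.christoffel_symm hx _ k i, hh.christoffel_symm hx _ j i,
    hh.christoffel_symm hx _ k j]
  ring

end

noncomputable section

variable {d : ℕ} {U : Set (Pt d)} {g h : TensorField d} {x : Pt d}

/-! ### The Ricci-DeTurck operator -/

/-- The quadratic terms of the Ricci-DeTurck operator, before contraction of `(i, m)` and `(r, s)`
with the inverse of the metric, as a function of `X = ∇ g`. -/
def quadTensor (X : Fin d → Matrix (Fin d) (Fin d) ℝ) (j k i m r s : Fin d) : ℝ :=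
  2 * (X i m r * lowDiff X s j k) - 2 * (X j m r * lowDiff X s i k)
    - 2 * (lowDiff X m i r * lowDiff X s j k) + 2 * (lowDiff X m j r * lowDiff X s i k)
    - X j m r * lowDiff X k i s - X k m r * lowDiff X j i s
    - lowDiff X i j k * lowDiff X m r s - lowDiff X i k j * lowDiff X m r s

/-- The full contraction of `quadTensor` with the inverse metric `K`. -/
def quadTerm (K : Matrix (Fin d) (Fin d) ℝ) (X : Fin d → Matrix (Fin d) (Fin d) ℝ) :
    Matrix (Fin d) (Fin d) ℝ :=
  Matrix.of fun j k => ∑ i, ∑ m, K i m * ∑ r, ∑ s, K r s * quadTensor X j k i m r s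

lemma sum_mul_sub_swap_eq_zero {K : Matrix (Fin d) (Fin d) ℝ} (hK : ∀ i j, K i j = K j i)
    (F : Fin d → Fin d → ℝ) : ∑ i, ∑ m, K i m * (F i m - F m i) = 0 := by
  simp only [mul_sub, Finset.sum_sub_distrib]
  rw [sub_eq_zero, Finset.sum_comm]
  exact Finset.sum_congr rfl fun i _ => Finset.sum_congr rfl fun m _ => by rw [hK]

lemma mul_four_apply (K X Y : Matrix (Fin d) (Fin d) ℝ) (i k : Fin d) :
    (K * (X * (K * Y))) i k = ∑ m, K i m * ∑ r, ∑ s, K r s * (X m r * Y s k) := by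
  simp only [Matrix.mul_apply, Finset.mul_sum]
  exact Finset.sum_congr rfl fun m _ => Finset.sum_congr rfl fun r _ =>
    Finset.sum_congr rfl fun s _ => by ring

lemma IsC2Metric.cov_lowDiffM (hg : IsC2Metric U g) (hh : IsC2Metric U h) (hx : x ∈ U)
    (a j m k : Fin d) :
    cov h a (lowDiffM h g j) x m k = lowDiff (fun b => cov2 h g a b x) m j k
      + ∑ p, christoffel h p a j x * lowDiff (fun a => cov h a g x) m p k := by
  rw [← hg.pd_lowDiff hh hx, cov_apply, nabla2]
  simp only [lowDiffM, Matrix.of_apply, Finset.sum_add_distrib]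
  ring

/-- The traced form of `IsC2Metric.curvM_sub`. -/
lemma IsC2Metric.ricci_sub (hg : IsC2Metric U g) (hh : IsC2Metric U h) (hx : x ∈ U)
    (j k : Fin d) :
    ricci g j k x = ricci h j k x
      + ∑ i, ∑ m, (g x)⁻¹ i m * (lowDiff (fun b => cov2 h g i b x) m j k
        - lowDiff (fun b => cov2 h g j b x) m i k)
      + ∑ i, ∑ m, (g x)⁻¹ i m * ∑ r, ∑ s, (g x)⁻¹ r s *
        (-(cov h i g x m r * lowDiff (fun a => cov h a g x) s j k)
          + cov h j g x m r * lowDiff (fun a => cov h a g x) s i k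
          + lowDiff (fun a => cov h a g x) m i r * lowDiff (fun a => cov h a g x) s j k
          - lowDiff (fun a => cov h a g x) m j r * lowDiff (fun a => cov h a g x) s i k) := by
  have h1 : ∀ i, riemannUp g i j k i x = curvM g i j x i k := fun _ => rfl
  have h2 : ∀ i, riemannUp h i j k i x = curvM h i j x i k := fun _ => rfl
  have h3 : ∀ i m, (cov h i (lowDiffM h g j) x - cov h j (lowDiffM h g i) x) m k
      = lowDiff (fun b => cov2 h g i b x) m j k - lowDiff (fun b => cov2 h g j b x) m i k :=
    fun i m => by
      rw [Matrix.sub_apply, hg.cov_lowDiffM hh hx, hg.cov_lowDiffM hh hx]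
      simp only [hh.christoffel_symm hx _ i j]
      ring
  unfold ricci
  simp only [h1, h2, hg.curvM_sub hh hx, Matrix.add_apply, Matrix.sub_apply, mul_four_apply]
  simp only [Matrix.mul_apply, h3]
  simp only [lowDiffM, Matrix.of_apply, mul_add, mul_sub, mul_neg, Finset.sum_add_distrib,
    Finset.sum_sub_distrib, Finset.sum_neg_distrib]
  ring

lemma IsC2Metric.deTurckForm_eq (hg : IsC2Metric U g) (hh : IsC2Metric U h) (hx : x ∈ U)
    (j : Fin d) :
    deTurckForm h g j x
      = ∑ p, ∑ q, (g x)⁻¹ p q * lowDiff (fun a => cov h a g x) j p q := by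
  have h1 : ∀ p q, ∑ k, g x j k * (christoffel g k p q x - christoffel h k p q x)
      = lowDiff (fun a => cov h a g x) j p q := fun p q => by
    have := congrFun (congrFun (hg.mul_conn_sub hh hx p) j) q
    simpa [Matrix.mul_apply, conn, lowDiffM, mul_sub, Finset.sum_sub_distrib] using this
  simp only [deTurckForm, deTurckField, ← h1, Finset.mul_sum]
  rw [Finset.sum_comm]
  refine Finset.sum_congr rfl fun p _ => ?_
  rw [Finset.sum_comm]
  exact Finset.sum_congr rfl fun q _ => Finset.sum_congr rfl fun k _ => by ring

/-- The covariant derivative of the DeTurck form with respect to `g` itself; the two quadratic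
terms come from `∇ g⁻¹` and from the difference of the connections. -/
lemma IsC2Metric.nabla1_deTurckForm (hg : IsC2Metric U g) (hh : IsC2Metric U h) (hx : x ∈ U)
    (j k : Fin d) :
    nabla1 g (deTurckForm h g) j k x
      = ∑ p, ∑ q, (g x)⁻¹ p q * lowDiff (fun b => cov2 h g j b x) k p q
      + ∑ i, ∑ m, (g x)⁻¹ i m * ∑ r, ∑ s, (g x)⁻¹ r s *
        (-(cov h j g x m r * lowDiff (fun a => cov h a g x) k i s)
          - lowDiff (fun a => cov h a g x) i j k * lowDiff (fun a => cov h a g x) m r s) := by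
  set B := lowDiff (fun a => cov h a g x) with hB
  -- the matrix `S` has the entries of the lowered difference with fixed first slot `k`
  let S : TensorField d := fun y => Matrix.of fun q p => lowDiff (fun a => cov h a g y) k p q
  have hX := fun b => hh.mdiffAt_cov hx (hg.contDiffAt x hx) b
  have hS : MDiffAt S x := fun q p =>
    (((hX p q k).fun_add (hX q p k)).fun_sub (hX k p q)).const_mul _
  have hW : pd j (deTurckForm h g k) x = (pdM j (fun y => (g y)⁻¹ * S y) x).trace := by
    rw [← pd_trace j ((hg.mdiffAt_inv hx).mul hS)]
    exact pd_congr j ((hg.eventually hx).mono fun y hy => hg.deTurckForm_eq hh hy k)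
  have hcov : ∀ p q, cov h j S x q p = lowDiff (fun b => cov2 h g j b x) k p q
      + ∑ m, christoffel h m j k x * B m p q := fun p q => by
    rw [← hg.pd_lowDiff hh hx, cov_apply, nabla2]
    simp only [S, hB, Matrix.of_apply, Finset.sum_add_distrib]
    ring
  have htr : (pdM j (fun y => (g y)⁻¹ * S y) x).trace
      = ((g x)⁻¹ * cov h j S x).trace
        - ((g x)⁻¹ * (cov h j g x * ((g x)⁻¹ * S x))).trace := by
    rw [pdM_mul j (hg.mdiffAt_inv hx) hS, hg.pdM_inv_eq hx h, pdM_eq_cov h S]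
    set K := (g x)⁻¹
    set Γ := conn h j x
    have e : (-(K * cov h j g x * K) - K * Γ.transpose - Γ * K) * S x
        + K * (cov h j S x + Γ.transpose * S x + S x * Γ)
        = K * cov h j S x - K * (cov h j g x * (K * S x))
          + ((K * S x) * Γ - Γ * (K * S x)) := by noncomm_ring
    rw [e, Matrix.trace_add, Matrix.trace_sub, Matrix.trace_sub, Matrix.trace_mul_comm _ Γ,
      sub_self, add_zero]
  have hΓ : ∀ m, christoffel g m j k x
      = christoffel h m j k x + ∑ i, (g x)⁻¹ m i * B i j k := fun m =>
    congrFun (congrFun (hg.conn_eq hh hx j) m) k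
  have hlast : ∑ m, (∑ i, (g x)⁻¹ m i * B i j k) * deTurckForm h g m x
      = ∑ i, ∑ m, (g x)⁻¹ i m * ∑ r, ∑ s, (g x)⁻¹ r s * (B i j k * B m r s) := by
    simp only [hg.deTurckForm_eq hh hx, ← hB, Finset.sum_mul]
    rw [Finset.sum_comm]
    refine Finset.sum_congr rfl fun i _ => Finset.sum_congr rfl fun m _ => ?_
    rw [hg.inv_symm hx m i, mul_assoc]
    congr 1
    simp only [Finset.mul_sum]
    exact Finset.sum_congr rfl fun r _ => Finset.sum_congr rfl fun s _ => by ring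
  have hΓW : ∑ m, christoffel h m j k x * deTurckForm h g m x
      = ∑ p, ∑ q, (g x)⁻¹ p q * ∑ m, christoffel h m j k x * B m p q := by
    simp only [hg.deTurckForm_eq hh hx, ← hB, Finset.mul_sum]
    rw [Finset.sum_comm]
    refine Finset.sum_congr rfl fun p _ => ?_
    rw [Finset.sum_comm]
    exact Finset.sum_congr rfl fun q _ => Finset.sum_congr rfl fun m _ => by ring
  unfold nabla1
  rw [hW, htr]
  simp only [hΓ, add_mul, Finset.sum_add_distrib, hlast, hΓW]
  simp only [Matrix.trace, Matrix.diag, mul_four_apply]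
  simp only [Matrix.mul_apply, hcov, S, Matrix.of_apply, ← hB, mul_add, mul_sub, mul_neg,
    Finset.sum_add_distrib, Finset.sum_sub_distrib, Finset.sum_neg_distrib]
  ring

/-- The contracted commutator `g^{im} (∇_j ∇_i - ∇_i ∇_j) g_{km}`. -/
lemma IsC2Metric.sum_inv_mul_cov2_comm (hg : IsC2Metric U g) (hh : IsC2Metric U h) (hx : x ∈ U)
    (j k : Fin d) :
    ∑ i, ∑ m, (g x)⁻¹ i m * (cov2 h g j i x k m - cov2 h g i j x k m)
      = ricci h j k x - ∑ i, ∑ m, (g x)⁻¹ i m * ∑ l, g x k l * riemannUp h j i m l x := by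
  have h1 : ∀ i m, cov2 h g j i x k m - cov2 h g i j x k m
      = ∑ l, riemannUp h i j k l x * g x l m - ∑ l, g x k l * riemannUp h j i m l x :=
    fun i m => by
      have := congrFun (congrFun (hh.cov2_sub_cov2 hx (hg.contDiffAt x hx) j i) k) m
      simp only [Matrix.sub_apply, Matrix.neg_apply, Matrix.mul_apply, Matrix.transpose_apply,
        curvM, Matrix.of_apply] at this
      rw [this, ← Finset.sum_neg_distrib]
      congr 1
      exact Finset.sum_congr rfl fun l _ => by rw [riemannUp_antisymm]; ring
  have h2 : ∀ i, ∑ m, (g x)⁻¹ i m * ∑ l, riemannUp h i j k l x * g x l m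
      = riemannUp h i j k i x := fun i => by
    have e : ∀ l, ∑ m, g x l m * (g x)⁻¹ m i = if l = i then 1 else 0 := fun l => by
      rw [← Matrix.mul_apply, hg.mul_inv hx, Matrix.one_apply]
    simp only [Finset.mul_sum]
    rw [Finset.sum_comm]
    have : ∀ l, ∑ m, (g x)⁻¹ i m * (riemannUp h i j k l x * g x l m)
        = riemannUp h i j k l x * ∑ m, g x l m * (g x)⁻¹ m i := fun l => by
      rw [Finset.mul_sum]
      exact Finset.sum_congr rfl fun m _ => by rw [hg.inv_symm hx i m]; ring
    simp [this, e]
  simp only [h1, mul_sub, Finset.sum_sub_distrib, h2]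
  rfl

/-- The contracted commutator `g^{im} (∇_j ∇_k - ∇_k ∇_j) g_{im}`, through the trace of the Bianchi
identity. -/
lemma IsC2Metric.sum_inv_mul_cov2_comm_trace (hg : IsC2Metric U g) (hh : IsC2Metric U h)
    (hx : x ∈ U) (j k : Fin d) :
    ∑ i, ∑ m, (g x)⁻¹ i m * (cov2 h g j k x i m - cov2 h g k j x i m)
      = 2 * (ricci h j k x - ricci h k j x) := by
  have h1 : ∑ i, ∑ m, (g x)⁻¹ i m * (cov2 h g j k x i m - cov2 h g k j x i m)
      = ((g x)⁻¹ * (cov2 h g j k x - cov2 h g k j x).transpose).trace := by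
    simp [Matrix.trace, Matrix.mul_apply]
  rw [h1, hh.cov2_sub_cov2 hx (hg.contDiffAt x hx)]
  simp only [Matrix.transpose_sub, Matrix.transpose_neg, Matrix.transpose_mul,
    Matrix.transpose_transpose, hg.transpose hx, Matrix.mul_sub, Matrix.mul_neg,
    Matrix.trace_sub, Matrix.trace_neg]
  rw [← Matrix.mul_assoc, hg.inv_mul hx, Matrix.one_mul, Matrix.trace_mul_comm,
    Matrix.mul_assoc, hg.mul_inv hx, Matrix.mul_one, Matrix.trace_transpose, hh.trace_curvM hx]
  ring

/-- The Ricci-DeTurck operator is strictly elliptic: with the DeTurck field, the second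
derivatives of `g` enter only through `g^{im} ∇_i ∇_m g`; the commutators of covariant derivatives
produce the curvature of the background metric `h`. -/
lemma IsC2Metric.ricciDeTurck_eq (hg : IsC2Metric U g) (hh : IsC2Metric U h) (hx : x ∈ U)
    (j k : Fin d) :
    -2 * ricci g j k x + nabla1 g (deTurckForm h g) j k x + nabla1 g (deTurckForm h g) k j x
      = ∑ i, ∑ m, (g x)⁻¹ i m * cov2 h g i m x j k
      - ∑ i, ∑ m, (g x)⁻¹ i m * ∑ l, g x k l * riemannUp h j i m l x
      - ∑ i, ∑ m, (g x)⁻¹ i m * ∑ l, g x j l * riemannUp h k i m l x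
      + quadTerm (g x)⁻¹ (fun a => cov h a g x) j k := by
  rw [hg.ricci_sub hh hx, hg.nabla1_deTurckForm hh hx, hg.nabla1_deTurckForm hh hx]
  have c1 := hg.sum_inv_mul_cov2_comm hh hx j k
  have c2 := hg.sum_inv_mul_cov2_comm hh hx k j
  have c3 := hg.sum_inv_mul_cov2_comm_trace hh hx j k
  have hY := fun a b i j => hg.cov2_symm (h := h) hx a b i j
  have c0 := sum_mul_sub_swap_eq_zero (hg.inv_symm hx) fun i m =>
    1 / 2 * cov2 h g j i x k m + 1 / 2 * cov2 h g k m x j i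
  -- the second order terms agree up to a part which is antisymmetric in `i` and `m`
  have key : -2 * ∑ i, ∑ m, (g x)⁻¹ i m * (lowDiff (fun b => cov2 h g i b x) m j k
        - lowDiff (fun b => cov2 h g j b x) m i k)
      + ∑ i, ∑ m, (g x)⁻¹ i m * lowDiff (fun b => cov2 h g j b x) k i m
      + ∑ i, ∑ m, (g x)⁻¹ i m * lowDiff (fun b => cov2 h g k b x) j i m
      = ∑ i, ∑ m, (g x)⁻¹ i m * cov2 h g i m x j k
      + ∑ i, ∑ m, (g x)⁻¹ i m * (cov2 h g j i x k m - cov2 h g i j x k m)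
      + ∑ i, ∑ m, (g x)⁻¹ i m * (cov2 h g k i x j m - cov2 h g i k x j m)
      + 1 / 2 * ∑ i, ∑ m, (g x)⁻¹ i m * (cov2 h g j k x i m - cov2 h g k j x i m)
      + ∑ i, ∑ m, (g x)⁻¹ i m * ((1 / 2 * cov2 h g j i x k m + 1 / 2 * cov2 h g k m x j i)
        - (1 / 2 * cov2 h g j m x k i + 1 / 2 * cov2 h g k i x j m)) := by
    simp only [Finset.mul_sum, ← Finset.sum_add_distrib]
    refine Finset.sum_congr rfl fun i _ => Finset.sum_congr rfl fun m _ => ?_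
    simp only [lowDiff]
    rw [hY j i m k, hY j m i k, hY k i m j, hY k m i j]
    ring
  rw [c0, c1, c2, c3] at key
  simp only [quadTerm, quadTensor, Matrix.of_apply]
  simp only [mul_add, mul_sub, mul_neg, Finset.sum_add_distrib,
    Finset.sum_sub_distrib, Finset.sum_neg_distrib] at key ⊢
  have e : ∀ f : Fin d → Fin d → Fin d → Fin d → ℝ,
      ∑ i, ∑ m, (g x)⁻¹ i m * ∑ r, ∑ s, (g x)⁻¹ r s * (2 * f i m r s)
        = 2 * ∑ i, ∑ m, (g x)⁻¹ i m * ∑ r, ∑ s, (g x)⁻¹ r s * f i m r s := fun f => by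
    simp only [Finset.mul_sum]
    exact Finset.sum_congr rfl fun i _ => Finset.sum_congr rfl fun m _ =>
      Finset.sum_congr rfl fun r _ => Finset.sum_congr rfl fun s _ => by ring
  simp only [e]
  linarith

end

noncomputable section

open scoped Topology

variable {d : ℕ} {U : Set (Pt d)} {g h : TensorField d} {x : Pt d}

/-! ### The evolution of the squared norm -/

lemma IsC2Metric.cov_sub_self (hg : IsC2Metric U g) (hh : IsC2Metric U h) (hx : x ∈ U)
    (a : Fin d) : cov h a (fun y => g y - h y) x = cov h a g x := by
  have h1 := hh.cov_self hx a
  unfold cov at h1 ⊢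
  rw [pdM_sub a (hg.mdiffAt hx) (hh.mdiffAt hx), Matrix.mul_sub, Matrix.sub_mul]
  refine Eq.trans ?_ (sub_zero _)
  rw [← h1]
  abel

lemma cov_congr {S T : TensorField d} (a : Fin d) (hST : S =ᶠ[𝓝 x] T) :
    cov h a S x = cov h a T x := by
  unfold cov
  rw [pdM_congr a hST, hST.eq_of_nhds]

lemma IsC2Metric.cov2_sub_self (hg : IsC2Metric U g) (hh : IsC2Metric U h) (hx : x ∈ U)
    (a b : Fin d) : cov2 h (fun y => g y - h y) a b x = cov2 h g a b x := by
  unfold cov2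
  rw [cov_congr a ((hh.eventually hx).mono fun y hy => hg.cov_sub_self hh hy b)]
  simp only [hg.cov_sub_self hh hx]

/-- Antisymmetry in the last two slots is the Ricci identity applied to `h`, as `∇ h = 0`. -/
lemma IsC2Metric.riemann_antisymm (hh : IsC2Metric U h) (hx : x ∈ U) (i j k l : Fin d) :
    riemann h i j k l x = -riemann h i j l k x := by
  have h0 : ∀ a b, cov2 h h a b x = 0 := fun a b => by
    unfold cov2
    rw [cov_congr (T := fun _ => 0) a ((hh.eventually hx).mono fun y hy => hh.cov_self hy b)]
    have : cov h a (fun _ => 0) x = 0 := by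
      ext i j; simp [cov, pdM, pd_const]
    simp [this, hh.cov_self hx]
  have h1 := hh.cov2_sub_cov2 hx (hh.contDiffAt x hx) i j
  rw [h0, h0, sub_self] at h1
  have h2 : (curvM h i j x).transpose * h x = (h x * curvM h i j x).transpose := by
    rw [Matrix.transpose_mul, hh.transpose hx]
  rw [h2] at h1
  have h3 := congrFun (congrFun h1 l) k
  have h4 : ∀ k l, riemann h i j k l x = (h x * curvM h i j x) l k := fun k l => by
    simp [riemann, Matrix.mul_apply, curvM]
  rw [h4, h4]
  simp only [Matrix.zero_apply, Matrix.sub_apply, Matrix.neg_apply, Matrix.transpose_apply] at h3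
  linarith

lemma IsC2Metric.curvatureError_antisymm (hh : IsC2Metric U h) (hx : x ∈ U) (i j k l : Fin d) :
    curvatureError h i j k l x = -curvatureError h i j l k x := by
  unfold curvatureError curvatureCC
  rw [hh.riemann_antisymm hx]; ring

/-- The tensor `g^{ab} g_{ip} h^{pq} E_{jaqb}`. -/
def errorTensor (h g : TensorField d) (x : Pt d) : Matrix (Fin d) (Fin d) ℝ :=
  Matrix.of fun i j => ∑ a, ∑ b, ∑ p, ∑ q,
    (g x)⁻¹ a b * g x i p * (h x)⁻¹ p q * curvatureError h j a q b x

lemma curvatureErrorTerm_eq_ip (hK : ((h x)⁻¹).transpose = (h x)⁻¹) :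
    curvatureErrorTerm h g x = 4 * ip (h x)⁻¹ (g x - h x) (errorTensor h g x) := by
  rw [ip_comm hK]
  unfold curvatureErrorTerm ip errorTensor
  congr 1
  exact Finset.sum_congr rfl fun i _ => Finset.sum_congr rfl fun j _ =>
    Finset.sum_congr rfl fun k _ => Finset.sum_congr rfl fun l _ => by
      rw [Matrix.of_apply]; ring

/-- The curvature of `h` in the Ricci-DeTurck operator, split into the part of constant curvature
`-1` and the deviation from it. -/
lemma IsC2Metric.sum_inv_mul_riemannUp (hg : IsC2Metric U g) (hh : IsC2Metric U h) (hx : x ∈ U)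
    (j k : Fin d) :
    ∑ i, ∑ m, (g x)⁻¹ i m * ∑ l, g x k l * riemannUp h j i m l x
      = -errorTensor h g x k j - ((g x)⁻¹ * h x).trace * g x k j + h x k j := by
  have hup : ∀ i m l, riemannUp h j i m l x
      = ∑ q, (h x)⁻¹ l q * riemann h j i m q x := fun i m l => by
    have : ((h x)⁻¹ * (h x * curvM h j i x)) l m = riemannUp h j i m l x := by
      rw [← Matrix.mul_assoc, hh.inv_mul hx, Matrix.one_mul]; rfl
    rw [← this, Matrix.mul_apply]
    exact Finset.sum_congr rfl fun q _ => by simp [riemann, Matrix.mul_apply, curvM]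
  have hR : ∀ i m q, riemann h j i m q x
      = -curvatureError h j i q m x - (h x j q * h x i m - h x j m * h x i q) := fun i m q => by
    rw [← neg_eq_iff_eq_neg.mpr (hh.curvatureError_antisymm hx j i m q)]
    simp only [curvatureError, curvatureCC]; ring
  have hδ : ∀ l m, ∑ q, (h x)⁻¹ l q * h x m q = if l = m then 1 else 0 := fun l m => by
    rw [← Matrix.one_apply, ← hh.inv_mul hx, Matrix.mul_apply]
    exact Finset.sum_congr rfl fun q _ => by rw [hh.symm hx m q]
  have hS : ∀ i m, ∑ l, g x k l * riemannUp h j i m l x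
      = -(∑ p, ∑ q, g x k p * (h x)⁻¹ p q * curvatureError h j i q m x)
        - g x k j * h x i m + g x k i * h x j m := fun i m => by
    have : ∀ l, riemannUp h j i m l x
        = -(∑ q, (h x)⁻¹ l q * curvatureError h j i q m x)
          - (∑ q, (h x)⁻¹ l q * h x j q) * h x i m
          + (∑ q, (h x)⁻¹ l q * h x i q) * h x j m := fun l => by
      rw [hup, Finset.sum_mul, Finset.sum_mul, ← Finset.sum_neg_distrib,
        ← Finset.sum_sub_distrib, ← Finset.sum_add_distrib]
      exact Finset.sum_congr rfl fun q _ => by rw [hR]; ring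
    simp only [this, hδ, mul_add, mul_sub, mul_neg, Finset.sum_add_distrib,
      Finset.sum_sub_distrib, Finset.sum_neg_distrib, Finset.mul_sum]
    simp [mul_assoc]
  have hlast : ∑ i, ∑ m, (g x)⁻¹ i m * (g x k i * h x j m) = h x k j := by
    have : (g x * ((g x)⁻¹ * h x)) k j = h x k j := by
      rw [← Matrix.mul_assoc, hg.mul_inv hx, Matrix.one_mul]
    rw [← this, Matrix.mul_apply]
    refine Finset.sum_congr rfl fun i _ => ?_
    rw [Matrix.mul_apply, Finset.mul_sum]
    exact Finset.sum_congr rfl fun m _ => by rw [hh.symm hx j m]; ring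
  have htr : ∑ i, ∑ m, (g x)⁻¹ i m * (g x k j * h x i m)
      = ((g x)⁻¹ * h x).trace * g x k j := by
    simp only [Matrix.trace, Matrix.diag, Matrix.mul_apply, Finset.sum_mul]
    exact Finset.sum_congr rfl fun i _ => Finset.sum_congr rfl fun m _ => by
      rw [hh.symm hx i m]; ring
  simp only [hS, mul_add, mul_sub, mul_neg, Finset.sum_add_distrib,
    Finset.sum_sub_distrib, Finset.sum_neg_distrib, hlast, htr]
  congr 3
  simp only [errorTensor, Matrix.of_apply, Finset.mul_sum, mul_assoc]

lemma ip_transpose_right {K Z : Matrix (Fin d) (Fin d) ℝ} (hZ : Z.transpose = Z)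
    (A : Matrix (Fin d) (Fin d) ℝ) : ip K Z A.transpose = ip K Z A := by
  unfold ip
  rw [Finset.sum_comm]
  refine Finset.sum_congr rfl fun i _ => Finset.sum_congr rfl fun j _ => ?_
  rw [Finset.sum_comm]
  refine Finset.sum_congr rfl fun i' _ => Finset.sum_congr rfl fun j' _ => ?_
  rw [Matrix.transpose_apply, show Z j i = Z i j from congrFun (congrFun hZ i) j]
  ring

lemma ip_smul_right (K A C : Matrix (Fin d) (Fin d) ℝ) (c : ℝ) :
    ip K A (c • C) = c * ip K A C := by
  simp [ip_eq_trace]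

/-- The right-hand side of the normalized Ricci-DeTurck flow, with constant `ν` in place of `n`. -/
def flowField (ν : ℝ) (h g : TensorField d) (x : Pt d) : Matrix (Fin d) (Fin d) ℝ :=
  Matrix.of fun i j => -2 * ν * g x i j - 2 * ricci g i j x
    + nabla1 g (deTurckForm h g) i j x + nabla1 g (deTurckForm h g) j i x

lemma IsC2Metric.flowField_eq (hg : IsC2Metric U g) (hh : IsC2Metric U h) (hx : x ∈ U) (ν : ℝ) :
    flowField ν h g x = (∑ i, ∑ m, (g x)⁻¹ i m • cov2 h g i m x)
      + (errorTensor h g x + (errorTensor h g x).transpose)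
      + (2 : ℝ) • ((((g x)⁻¹ * h x).trace - ν) • g x - h x)
      + quadTerm (g x)⁻¹ (fun a => cov h a g x) := by
  ext j k
  have h1 := hg.ricciDeTurck_eq hh hx j k
  rw [hg.sum_inv_mul_riemannUp hh hx, hg.sum_inv_mul_riemannUp hh hx] at h1
  simp only [flowField, Matrix.of_apply, Matrix.add_apply, Matrix.sub_apply, Matrix.smul_apply,
    Matrix.sum_apply, Matrix.transpose_apply, smul_eq_mul]
  rw [hg.symm hx k j, hh.symm hx k j] at h1
  linarith

/-- The evolution equation of `|g - h|²`, in the form `2 ⟨∂_t g, g - h⟩ = …`. -/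
lemma IsC2Metric.ip_flowField (hg : IsC2Metric U g) (hh : IsC2Metric U h) (hx : x ∈ U) (ν : ℝ) :
    2 * ip (h x)⁻¹ (g x - h x) (flowField ν h g x)
      = (∑ i, ∑ j, (g x)⁻¹ i j * hess h (fun y => normSq2 (h y) (g y - h y)) i j x)
        - 2 * (∑ i, ∑ j, (g x)⁻¹ i j * ip (h x)⁻¹ (cov h i g x) (cov h j g x))
        + curvatureErrorTerm h g x
        + 4 * ip (h x)⁻¹ (g x - h x) ((((g x)⁻¹ * h x).trace - ν) • g x - h x)
        + 2 * ip (h x)⁻¹ (g x - h x) (quadTerm (g x)⁻¹ fun a => cov h a g x) := by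
  have hZ : (g x - h x).transpose = g x - h x := by
    rw [Matrix.transpose_sub, hg.transpose hx, hh.transpose hx]
  have hZ2 : ∀ y ∈ U, ∀ i j, ContDiffAt ℝ 2 (fun y => (g y - h y) i j) y := fun y hy i j =>
    (hg.contDiffAt y hy i j).sub (hh.contDiffAt y hy i j)
  have hK := hh.inv_transpose hx
  have h1 : ∑ i, ∑ j, (g x)⁻¹ i j * hess h (fun y => normSq2 (h y) (g y - h y)) i j x
      = 2 * ip (h x)⁻¹ (g x - h x) (∑ i, ∑ m, (g x)⁻¹ i m • cov2 h g i m x)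
        + 2 * (∑ i, ∑ j, (g x)⁻¹ i j * ip (h x)⁻¹ (cov h i g x) (cov h j g x)) := by
    rw [ip_comm hK, ip_sum_left]
    simp only [ip_sum_left, ip_smul_left, Finset.mul_sum, ← Finset.sum_add_distrib]
    refine Finset.sum_congr rfl fun i _ => Finset.sum_congr rfl fun j _ => ?_
    rw [hh.hess_normSq2 hx hZ2, hg.cov2_sub_self hh hx, hg.cov_sub_self hh hx,
      hg.cov_sub_self hh hx]
    ring
  rw [h1, hg.flowField_eq hh hx, curvatureErrorTerm_eq_ip hK]
  simp only [ip_add_right, ip_transpose_right hZ, ip_smul_right]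
  ring

/-- The derivative in time of the squared distance of a family of matrices from `q`. -/
lemma hasDerivAt_normSq2 {q : Matrix (Fin d) (Fin d) ℝ} (hq : (q⁻¹).transpose = q⁻¹)
    {A : ℝ → Matrix (Fin d) (Fin d) ℝ} {D : Matrix (Fin d) (Fin d) ℝ} {t : ℝ}
    (hA : ∀ i j, HasDerivAt (fun s => A s i j) (D i j) t) :
    HasDerivAt (fun s => normSq2 q (A s - q)) (2 * ip q⁻¹ (A t - q) D) t := by
  have hZ : ∀ i j, HasDerivAt (fun s => (A s - q) i j) (D i j) t := fun i j =>
    (hA i j).sub_const _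
  have h1 : 2 * ip q⁻¹ (A t - q) D
      = ∑ i, ∑ j, ∑ i', ∑ j', (q⁻¹ i i' * q⁻¹ j j' * D i j * (A t - q) i' j'
        + q⁻¹ i i' * q⁻¹ j j' * (A t - q) i j * D i' j') := by
    rw [two_mul]
    nth_rewrite 1 [ip_comm hq]
    simp only [Finset.sum_add_distrib, ip]
  rw [h1]
  exact HasDerivAt.fun_sum fun i _ => HasDerivAt.fun_sum fun j _ => HasDerivAt.fun_sum fun i' _ =>
    HasDerivAt.fun_sum fun j' _ => ((hZ i j).const_mul _).mul (hZ i' j')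

end

noncomputable section

variable {d : ℕ}

/-! ### Frames diagonalizing two inner products -/

/-- The value of the linear form with components `f` on the `a`-th column of `P`. Nested, it gives
the components of a tensor in the frame formed by the columns of `P`. -/
def ev (P : Matrix (Fin d) (Fin d) ℝ) (a : Fin d) (f : Fin d → ℝ) : ℝ := ∑ i, P i a * f i

section ev

variable {P : Matrix (Fin d) (Fin d) ℝ}

lemma ev_mul_left (a : Fin d) (c : ℝ) (f : Fin d → ℝ) :
    ev P a (fun i => c * f i) = c * ev P a f := by
  simp only [ev, Finset.mul_sum]; exact Finset.sum_congr rfl fun i _ => by ring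

lemma ev_mul_right (a : Fin d) (c : ℝ) (f : Fin d → ℝ) :
    ev P a (fun i => f i * c) = ev P a f * c := by
  simp only [ev, Finset.sum_mul]; exact Finset.sum_congr rfl fun i _ => by ring

lemma ev_add (a : Fin d) (f f' : Fin d → ℝ) :
    ev P a (fun i => f i + f' i) = ev P a f + ev P a f' := by
  simp only [ev, mul_add, Finset.sum_add_distrib]

lemma ev_sub (a : Fin d) (f f' : Fin d → ℝ) :
    ev P a (fun i => f i - f' i) = ev P a f - ev P a f' := by
  simp only [ev, mul_sub, Finset.sum_sub_distrib]

lemma ev_sum {ι : Type*} [Fintype ι] (a : Fin d) (f : Fin d → ι → ℝ) :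
    ev P a (fun i => ∑ m, f i m) = ∑ m, ev P a (fun i => f i m) := by
  simp only [ev, Finset.mul_sum]; exact Finset.sum_comm

lemma ev_sum_mul_left {ι : Type*} [Fintype ι] (a : Fin d) (c : ι → ℝ) (f : Fin d → ι → ℝ) :
    ev P a (fun i => ∑ m, c m * f i m) = ∑ m, c m * ev P a (fun i => f i m) := by
  simp only [ev_sum, ev_mul_left]

lemma ev_zero (a : Fin d) : ev P a (fun _ => 0) = 0 := by simp [ev]

lemma ev_comm (a b : Fin d) (f : Fin d → Fin d → ℝ) :
    ev P a (fun i => ev P b (fun j => f i j)) = ev P b (fun j => ev P a (fun i => f i j)) := by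
  simp only [ev, Finset.mul_sum]
  rw [Finset.sum_comm]
  exact Finset.sum_congr rfl fun j _ => Finset.sum_congr rfl fun i _ => by ring

lemma ev_ev_eq (a b : Fin d) (A : Matrix (Fin d) (Fin d) ℝ) :
    ev P a (fun i => ev P b (fun j => A i j)) = (P.transpose * A * P) a b := by
  simp only [ev, Matrix.mul_apply, Matrix.transpose_apply, Finset.mul_sum, Finset.sum_mul]
  rw [Finset.sum_comm]
  exact Finset.sum_congr rfl fun j _ => Finset.sum_congr rfl fun i _ => by ring

end ev

/-- The columns of `P` are orthonormal for `H`, and orthogonal for `G` with squared lengths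
`lam`. -/
structure IsFrame (H G P : Matrix (Fin d) (Fin d) ℝ) (lam : Fin d → ℝ) : Prop where
  orthonormal : P.transpose * H * P = 1
  diagonal : P.transpose * G * P = Matrix.diagonal lam
  pos : ∀ a, 0 < lam a

open scoped MatrixOrder in
/-- Simultaneous diagonalization of two inner products. -/
lemma exists_isFrame {H G : Matrix (Fin d) (Fin d) ℝ} (hH : H.PosDef) (hG : G.PosDef) :
    ∃ P lam, IsFrame H G P lam := by
  obtain ⟨B, hB⟩ := CStarAlgebra.nonneg_iff_eq_star_mul_self.mp hH.posSemidef.nonneg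
  rw [Matrix.star_eq_conjTranspose, Matrix.conjTranspose_eq_transpose_of_trivial] at hB
  -- with `H = Bᵀ B`, an orthogonal matrix diagonalizing `B⁻ᵀ G B⁻¹` gives the frame
  have hBu : IsUnit B.det := by
    have := hH.det_pos.ne'
    rw [hB, Matrix.det_mul] at this
    exact isUnit_iff_ne_zero.mpr (right_ne_zero_of_mul this)
  have hBB : B * B⁻¹ = 1 := Matrix.mul_nonsing_inv _ hBu
  have hS : (B⁻¹.transpose * G * B⁻¹).IsHermitian := by
    have := hG.isHermitian
    unfold Matrix.IsHermitian at this ⊢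
    rw [Matrix.conjTranspose_eq_transpose_of_trivial] at this ⊢
    simp only [Matrix.transpose_mul, Matrix.transpose_transpose, this, Matrix.mul_assoc]
  set V : Matrix (Fin d) (Fin d) ℝ := (hS.eigenvectorUnitary).1 with hV
  have hVV : V.transpose * V = 1 := by
    have := Matrix.mem_unitaryGroup_iff'.mp hS.eigenvectorUnitary.2
    rwa [Matrix.star_eq_conjTranspose, Matrix.conjTranspose_eq_transpose_of_trivial] at this
  have hspec : V.transpose * (B⁻¹.transpose * G * B⁻¹) * V = Matrix.diagonal hS.eigenvalues := by
    have h1 := hS.spectral_theorem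
    rw [Unitary.conjStarAlgAut_apply] at h1
    have h2 : B⁻¹.transpose * G * B⁻¹ = V * Matrix.diagonal hS.eigenvalues * V.transpose := by
      rw [← Matrix.conjTranspose_eq_transpose_of_trivial V, ← Matrix.star_eq_conjTranspose]
      exact h1
    calc V.transpose * (B⁻¹.transpose * G * B⁻¹) * V
        = V.transpose * (V * Matrix.diagonal hS.eigenvalues * V.transpose) * V :=
          congrArg (fun M => V.transpose * M * V) h2
      _ = (V.transpose * V) * Matrix.diagonal hS.eigenvalues * (V.transpose * V) := by
          simp only [Matrix.mul_assoc]
      _ = _ := by rw [hVV, Matrix.one_mul, Matrix.mul_one]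
  have hdiag : (B⁻¹ * V).transpose * G * (B⁻¹ * V) = Matrix.diagonal hS.eigenvalues := by
    rw [← hspec, Matrix.transpose_mul]
    simp only [Matrix.mul_assoc]
  have horth : (B⁻¹ * V).transpose * H * (B⁻¹ * V) = 1 := by
    rw [hB, Matrix.transpose_mul]
    calc V.transpose * B⁻¹.transpose * (B.transpose * B) * (B⁻¹ * V)
        = V.transpose * (B * B⁻¹).transpose * (B * B⁻¹) * V := by
          rw [Matrix.transpose_mul]; simp only [Matrix.mul_assoc]
      _ = 1 := by rw [hBB, Matrix.transpose_one, Matrix.mul_one, Matrix.mul_one, hVV]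
  refine ⟨B⁻¹ * V, hS.eigenvalues, horth, hdiag, fun a => ?_⟩
  have hinj : Function.Injective (B⁻¹ * V).mulVec := by
    refine Function.LeftInverse.injective (g := ((B⁻¹ * V).transpose * H).mulVec) fun v => ?_
    rw [Matrix.mulVec_mulVec, horth, Matrix.one_mulVec]
  have hpd := hG.conjTranspose_mul_mul_same hinj
  rw [Matrix.conjTranspose_eq_transpose_of_trivial, hdiag, Matrix.posDef_diagonal_iff] at hpd
  exact hpd a

lemma sum_comm_three (F : Fin d → Fin d → Fin d → ℝ) :
    ∑ i, ∑ j, ∑ k, F i j k = ∑ k, ∑ i, ∑ j, F i j k := by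
  rw [Finset.sum_comm (f := fun k i => ∑ j, F i j k)]
  exact Finset.sum_congr rfl fun i _ => Finset.sum_comm

lemma sum_comm_four (F : Fin d → Fin d → Fin d → Fin d → ℝ) :
    ∑ i, ∑ j, ∑ k, ∑ l, F i j k l = ∑ l, ∑ i, ∑ j, ∑ k, F i j k l := by
  rw [Finset.sum_comm (f := fun l i => ∑ j, ∑ k, F i j k l)]
  exact Finset.sum_congr rfl fun i _ => sum_comm_three _

namespace IsFrame

variable {H G P : Matrix (Fin d) (Fin d) ℝ} {lam : Fin d → ℝ}

lemma inv_left (hP : IsFrame H G P lam) : H⁻¹ = P * P.transpose := by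
  refine Matrix.inv_eq_left_inv ?_
  have := mul_eq_one_comm.mp hP.orthonormal
  rw [Matrix.mul_assoc, this]

lemma inv_right (hP : IsFrame H G P lam) :
    G⁻¹ = P * Matrix.diagonal (fun a => (lam a)⁻¹) * P.transpose := by
  refine Matrix.inv_eq_left_inv ?_
  have h1 : (Matrix.diagonal (fun a => (lam a)⁻¹) * (P.transpose * G)) * P = 1 := by
    rw [Matrix.mul_assoc, hP.diagonal, Matrix.diagonal_mul_diagonal, ← Matrix.diagonal_one]
    congr 1
    funext a
    exact inv_mul_cancel₀ (hP.pos a).ne'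
  rw [← mul_eq_one_comm.mp h1]
  simp only [Matrix.mul_assoc]

/-- Contraction with `G⁻¹` in the frame. -/
lemma sum_inv_right (hP : IsFrame H G P lam) (F : Fin d → Fin d → ℝ) :
    ∑ i, ∑ j, G⁻¹ i j * F i j
      = ∑ a, (lam a)⁻¹ * ev P a (fun i => ev P a (fun j => F i j)) := by
  have h1 : ∀ i j, G⁻¹ i j = ∑ a, P i a * (lam a)⁻¹ * P j a := fun i j => by
    rw [hP.inv_right, Matrix.mul_apply]
    simp only [Matrix.mul_diagonal, Matrix.transpose_apply]
  simp only [h1, ev, Finset.mul_sum, Finset.sum_mul]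
  rw [Finset.sum_comm' (t' := Finset.univ) (s' := fun _ => Finset.univ) (by simp)]
  have : ∀ j, ∑ i, ∑ a, P i a * (lam a)⁻¹ * P j a * F i j
      = ∑ a, ∑ i, (lam a)⁻¹ * (P i a * (P j a * F i j)) := fun j => by
    rw [Finset.sum_comm]
    exact Finset.sum_congr rfl fun a _ => Finset.sum_congr rfl fun i _ => by ring
  simp only [this]
  rw [Finset.sum_comm]
  exact Finset.sum_congr rfl fun a _ => Finset.sum_comm

lemma self (hP : IsFrame H G P lam) : IsFrame H H P (fun _ => 1) :=
  ⟨hP.orthonormal, by rw [hP.orthonormal, ← Matrix.diagonal_one], fun _ => one_pos⟩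

/-- Contraction with `H⁻¹` in the frame. -/
lemma sum_inv_left (hP : IsFrame H G P lam) (F : Fin d → Fin d → ℝ) :
    ∑ i, ∑ j, H⁻¹ i j * F i j = ∑ a, ev P a (fun i => ev P a (fun j => F i j)) := by
  simpa using hP.self.sum_inv_right F

lemma ip_eq (hP : IsFrame H G P lam) (A B : Matrix (Fin d) (Fin d) ℝ) :
    ip H⁻¹ A B = ∑ a, ∑ b, ev P a (fun i => ev P b (fun j => A i j))
      * ev P a (fun i => ev P b (fun j => B i j)) := by
  have h1 : ip H⁻¹ A B
      = ∑ i, ∑ i', H⁻¹ i i' * ∑ j, ∑ j', H⁻¹ j j' * (A i j * B i' j') := by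
    simp only [ip, Finset.mul_sum]
    refine Finset.sum_congr rfl fun i _ => ?_
    rw [Finset.sum_comm]
    exact Finset.sum_congr rfl fun i' _ => Finset.sum_congr rfl fun j _ =>
      Finset.sum_congr rfl fun j' _ => by ring
  rw [h1]
  simp only [hP.sum_inv_left, ev_mul_left, ev_mul_right, ev_sum]

end IsFrame

end

noncomputable section

variable {d : ℕ} {H G P : Matrix (Fin d) (Fin d) ℝ} {lam : Fin d → ℝ}

namespace IsFrame

lemma normSq3_eq (hP : IsFrame H G P lam) (X : Fin d → Fin d → Fin d → ℝ) :
    normSq3 H X = ∑ a, ∑ b, ∑ c,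
      ev P a (fun i => ev P b (fun j => ev P c (fun k => X i j k))) ^ 2 := by
  have h1 : normSq3 H X = ∑ i, ∑ i', H⁻¹ i i' * ∑ j, ∑ j', H⁻¹ j j' *
      ∑ k, ∑ k', H⁻¹ k k' * (X i j k * X i' j' k') := by
    simp only [normSq3, Finset.mul_sum]
    refine Finset.sum_congr rfl fun i _ => ?_
    symm
    refine Finset.sum_comm.trans (Finset.sum_congr rfl fun j _ => ?_)
    refine (sum_comm_three _).trans ?_
    exact Finset.sum_congr rfl fun k _ => Finset.sum_congr rfl fun i' _ =>
      Finset.sum_congr rfl fun j' _ => Finset.sum_congr rfl fun k' _ => by ring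
  rw [h1]
  simp only [hP.sum_inv_left, ev_mul_left, ev_mul_right, ev_sum, sq]

lemma normSq4_eq (hP : IsFrame H G P lam) (X : Fin d → Fin d → Fin d → Fin d → ℝ) :
    normSq4 H X = ∑ a, ∑ b, ∑ c, ∑ e,
      ev P a (fun i => ev P b (fun j => ev P c (fun k => ev P e (fun l => X i j k l)))) ^ 2 := by
  have h1 : normSq4 H X = ∑ i, ∑ i', H⁻¹ i i' * ∑ j, ∑ j', H⁻¹ j j' *
      ∑ k, ∑ k', H⁻¹ k k' * ∑ l, ∑ l', H⁻¹ l l' * (X i j k l * X i' j' k' l') := by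
    simp only [normSq4, Finset.mul_sum]
    refine Finset.sum_congr rfl fun i _ => ?_
    symm
    refine Finset.sum_comm.trans (Finset.sum_congr rfl fun j _ => ?_)
    refine (sum_comm_three _).trans ?_
    refine Finset.sum_congr rfl fun k _ => ?_
    refine (sum_comm_four _).trans ?_
    exact Finset.sum_congr rfl fun l _ => Finset.sum_congr rfl fun i' _ =>
      Finset.sum_congr rfl fun j' _ => Finset.sum_congr rfl fun k' _ =>
      Finset.sum_congr rfl fun l' _ => by ring
  rw [h1]
  simp only [hP.sum_inv_left, ev_mul_left, ev_mul_right, ev_sum, sq]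

lemma sq_le_normSq3 (hP : IsFrame H G P lam) (X : Fin d → Fin d → Fin d → ℝ) (a b c : Fin d) :
    ev P a (fun i => ev P b (fun j => ev P c (fun k => X i j k))) ^ 2 ≤ normSq3 H X := by
  rw [hP.normSq3_eq]
  refine le_trans ?_ (Finset.single_le_sum (fun a _ => ?_) (Finset.mem_univ a))
  · refine le_trans ?_ (Finset.single_le_sum (fun b _ => ?_) (Finset.mem_univ b))
    · exact Finset.single_le_sum
        (f := fun c => ev P a (fun i => ev P b (fun j => ev P c (fun k => X i j k))) ^ 2)
        (fun c _ => sq_nonneg _) (Finset.mem_univ c)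
    · exact Finset.sum_nonneg fun c _ => sq_nonneg _
  · exact Finset.sum_nonneg fun b _ => Finset.sum_nonneg fun c _ => sq_nonneg _

lemma sq_le_normSq4 (hP : IsFrame H G P lam) (X : Fin d → Fin d → Fin d → Fin d → ℝ)
    (a b c e : Fin d) :
    ev P a (fun i => ev P b (fun j => ev P c (fun k => ev P e (fun l => X i j k l)))) ^ 2
      ≤ normSq4 H X := by
  rw [hP.normSq4_eq]
  refine le_trans ?_ (Finset.single_le_sum (fun a _ => ?_) (Finset.mem_univ a))
  · refine le_trans ?_ (Finset.single_le_sum (fun b _ => ?_) (Finset.mem_univ b))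
    · refine le_trans ?_ (Finset.single_le_sum (fun c _ => ?_) (Finset.mem_univ c))
      · exact Finset.single_le_sum (f := fun e => ev P a (fun i => ev P b (fun j =>
          ev P c (fun k => ev P e (fun l => X i j k l)))) ^ 2)
          (fun e _ => sq_nonneg _) (Finset.mem_univ e)
      · exact Finset.sum_nonneg fun e _ => sq_nonneg _
    · exact Finset.sum_nonneg fun c _ => Finset.sum_nonneg fun e _ => sq_nonneg _
  · exact Finset.sum_nonneg fun b _ => Finset.sum_nonneg fun c _ =>
      Finset.sum_nonneg fun e _ => sq_nonneg _

lemma ev_ev_left (hP : IsFrame H G P lam) (a b : Fin d) :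
    ev P a (fun i => ev P b (fun j => H i j)) = if a = b then 1 else 0 := by
  rw [ev_ev_eq, hP.orthonormal, Matrix.one_apply]

lemma ev_ev_right (hP : IsFrame H G P lam) (a b : Fin d) :
    ev P a (fun i => ev P b (fun j => G i j)) = if a = b then lam a else 0 := by
  rw [ev_ev_eq, hP.diagonal, Matrix.diagonal_apply]

lemma ev_ev_sub (hP : IsFrame H G P lam) (a b : Fin d) :
    ev P a (fun i => ev P b (fun j => (G - H) i j)) = if a = b then lam a - 1 else 0 := by
  simp only [Matrix.sub_apply, ev_sub, hP.ev_ev_left, hP.ev_ev_right]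
  split_ifs <;> simp

lemma ip_sub_eq (hP : IsFrame H G P lam) (B : Matrix (Fin d) (Fin d) ℝ) :
    ip H⁻¹ (G - H) B = ∑ a, (lam a - 1) * ev P a (fun i => ev P a (fun j => B i j)) := by
  rw [hP.ip_eq]
  simp only [hP.ev_ev_sub, ite_mul, zero_mul, Finset.sum_ite_eq, Finset.mem_univ, if_true]

lemma normSq2_sub_eq (hP : IsFrame H G P lam) :
    normSq2 H (G - H) = ∑ a, (lam a - 1) ^ 2 := by
  rw [normSq2_eq_ip, hP.ip_sub_eq]
  simp only [hP.ev_ev_sub, if_true, sq]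

/-- Lowering an index with `G` and raising it with `H⁻¹` is diagonal in the frame. -/
lemma ev_sum_mul_inv (hP : IsFrame H G P lam) (c : Fin d) (f : Fin d → ℝ) :
    ev P c (fun i => ∑ p, ∑ q, G i p * H⁻¹ p q * f q) = lam c * ev P c f := by
  have h1 : P.transpose * (G * H⁻¹) = Matrix.diagonal lam * P.transpose := by
    rw [hP.inv_left, ← hP.diagonal]; simp only [Matrix.mul_assoc]
  have h2 : ∀ q, ev P c (fun i => ∑ p, G i p * H⁻¹ p q) = lam c * P q c := fun q => by
    have := congrFun (congrFun h1 c) q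
    rw [Matrix.diagonal_mul] at this
    simpa only [ev, Matrix.mul_apply, Matrix.transpose_apply] using this
  have h3 : ∀ i, ∑ p, ∑ q, G i p * H⁻¹ p q * f q = ∑ q, (∑ p, G i p * H⁻¹ p q) * f q :=
    fun i => by rw [Finset.sum_comm]; simp only [Finset.sum_mul]
  simp only [h3]
  rw [ev_sum]
  simp only [ev_mul_right, h2]
  simp only [ev, Finset.mul_sum, mul_assoc]

end IsFrame

/-! ### Pointwise estimates -/

/-- All components of the `3`-tensor `T` in the frame `P` are at most `C`. -/
def FrameBdd (P : Matrix (Fin d) (Fin d) ℝ) (C : ℝ) (T : Fin d → Fin d → Fin d → ℝ) : Prop :=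
  ∀ a b c, |ev P a (fun i => ev P b (fun j => ev P c (fun k => T i j k)))| ≤ C

namespace FrameBdd

variable {C : ℝ} {T : Fin d → Fin d → Fin d → ℝ}

lemma swap_left (hT : FrameBdd P C T) : FrameBdd P C (fun i j k => T j i k) := fun a b c => by
  rw [ev_comm a b fun i j => ev P c fun k => T j i k]; exact hT b a c

lemma swap_right (hT : FrameBdd P C T) : FrameBdd P C (fun i j k => T i k j) := fun a b c => by
  have : ∀ i, ev P b (fun j => ev P c (fun k => T i k j))
      = ev P c (fun k => ev P b (fun j => T i k j)) := fun i => ev_comm b c _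
  simp only [this]; exact hT a c b

lemma rotate (hT : FrameBdd P C T) : FrameBdd P C (fun i j k => T k i j) :=
  hT.swap_left.swap_right

lemma rotate' (hT : FrameBdd P C T) : FrameBdd P C (fun i j k => T j k i) :=
  hT.rotate.rotate

lemma lowDiff {X : Fin d → Matrix (Fin d) (Fin d) ℝ}
    (hX : FrameBdd P C fun i j k => X i j k) :
    FrameBdd P (3 / 2 * C) (fun m j k => lowDiff X m j k) := fun a b c => by
  have h1 := hX.rotate' a b c
  have h2 := hX.rotate'.swap_right a b c
  have h3 := hX a b c
  simp only [_root_.lowDiff, ev_mul_left, ev_add, ev_sub]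
  rw [abs_le] at *
  dsimp only at h1 h2 h3
  constructor <;> linarith [h1.1, h1.2, h2.1, h2.2, h3.1, h3.2]

end FrameBdd

/-- The quadratic terms are bounded by `|X|²` in a frame. -/
lemma abs_ev_quadTensor_le {X : Fin d → Matrix (Fin d) (Fin d) ℝ} {C : ℝ}
    (hX : FrameBdd P C fun i j k => X i j k) (a c e : Fin d) :
    |ev P a (fun j => ev P a (fun k => ev P c (fun i => ev P c (fun m =>
      ev P e (fun r => ev P e (fun s => quadTensor X j k i m r s))))))| ≤ 23 * C ^ 2 := by
  have hC : 0 ≤ C := (abs_nonneg _).trans (hX a a a)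
  have hB := hX.lowDiff
  have hmul : ∀ {u v U V : ℝ}, |u| ≤ U → |v| ≤ V → |u * v| ≤ U * V := fun hu hv => by
    rw [abs_mul]; exact mul_le_mul hu hv (abs_nonneg _) ((abs_nonneg _).trans hu)
  -- one bound for each of the eight products in `quadTensor`: their total is `22.5 C²`
  have t1 := hmul (hX c c e) (hB.rotate a a e)
  have t2 := hmul (hX a c e) (hB.rotate.swap_left a c e)
  have t3 := hmul (hB.swap_left c c e) (hB.rotate a a e)
  have t4 := hmul (hB.swap_left a c e) (hB.rotate.swap_left a c e)
  have t5 := hmul (hX a c e) (hB a c e)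
  have t6 := hmul (hB a c e) (hX a c e)
  have t7 := hmul (hB.rotate a a c) (hB c e e)
  have t8 := hmul (hB.rotate.swap_left a a c) (hB c e e)
  simp only [quadTensor, ev_add, ev_sub, ev_mul_left, ev_mul_right]
  rw [abs_le] at *
  dsimp only at t1 t2 t3 t4 t5 t6 t7 t8
  constructor <;> nlinarith

end

noncomputable section

variable {d : ℕ} {H G P : Matrix (Fin d) (Fin d) ℝ} {lam : Fin d → ℝ} {ε : ℝ}

/-- `ε`-closeness, evaluated on the frame vectors. -/
lemma IsFrame.bounds (hP : IsFrame H G P lam)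
    (hGH : ∀ v : Fin d → ℝ, (1 + ε)⁻¹ * (v ⬝ᵥ H.mulVec v) ≤ v ⬝ᵥ G.mulVec v ∧
      v ⬝ᵥ G.mulVec v ≤ (1 + ε) * (v ⬝ᵥ H.mulVec v)) (a : Fin d) :
    (1 + ε)⁻¹ ≤ lam a ∧ lam a ≤ 1 + ε := by
  have h1 : ∀ A : Matrix (Fin d) (Fin d) ℝ,
      (fun i => P i a) ⬝ᵥ A.mulVec (fun i => P i a) = (P.transpose * A * P) a a := fun A => by
    rw [Matrix.mul_assoc]
    simp [dotProduct, Matrix.mulVec, Matrix.mul_apply]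
  have := hGH fun i => P i a
  rw [h1, h1, hP.orthonormal, hP.diagonal, Matrix.one_apply_eq, Matrix.diagonal_apply_eq,
    mul_one, mul_one] at this
  exact this

/-- `lam` takes values in `[(1 + ε)⁻¹, 1 + ε]`, with `0 < ε ≤ 1`. -/
structure EigenvaluesNear (ε : ℝ) (lam : Fin d → ℝ) : Prop where
  pos : 0 < ε
  le_one : ε ≤ 1
  mem : ∀ a, (1 + ε)⁻¹ ≤ lam a ∧ lam a ≤ 1 + ε

namespace EigenvaluesNear

lemma lam_pos (hl : EigenvaluesNear ε lam) (a : Fin d) : 0 < lam a :=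
  lt_of_lt_of_le (inv_pos.mpr (by linarith [hl.pos])) (hl.mem a).1

lemma lam_le_two (hl : EigenvaluesNear ε lam) (a : Fin d) : lam a ≤ 2 := by
  linarith [(hl.mem a).2, hl.le_one]

lemma inv_le (hl : EigenvaluesNear ε lam) (a : Fin d) : (lam a)⁻¹ ≤ 2 := by
  have h1 : (lam a)⁻¹ ≤ 1 + ε := inv_le_of_inv_le₀ (by linarith [hl.pos]) (hl.mem a).1
  linarith [hl.le_one]

lemma one_sub_le_inv (hl : EigenvaluesNear ε lam) (a : Fin d) : 1 - ε ≤ (lam a)⁻¹ := by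
  have h0 := hl.pos
  have h1 : (1 + ε)⁻¹ ≤ (lam a)⁻¹ := inv_anti₀ (hl.lam_pos a) (hl.mem a).2
  refine le_trans ?_ h1
  rw [← one_div, le_div_iff₀ (by linarith)]; nlinarith

lemma abs_sub_one_le (hl : EigenvaluesNear ε lam) (a : Fin d) : |lam a - 1| ≤ ε := by
  have h0 := hl.pos
  have h1 : 1 - ε ≤ (1 + ε)⁻¹ := by
    rw [← one_div, le_div_iff₀ (by linarith)]; nlinarith
  rw [abs_le]
  constructor <;> linarith [(hl.mem a).1, (hl.mem a).2]

lemma abs_inv_sub_one_le (hl : EigenvaluesNear ε lam) (a : Fin d) :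
    |(lam a)⁻¹ - 1| ≤ 2 * |lam a - 1| := by
  have h0 := hl.lam_pos a
  have h1 : (lam a)⁻¹ - 1 = -((lam a)⁻¹ * (lam a - 1)) := by field_simp; ring
  rw [h1, abs_neg, abs_mul, abs_of_pos (inv_pos.mpr h0)]
  exact mul_le_mul_of_nonneg_right (hl.inv_le a) (abs_nonneg _)

lemma sum_abs_sub_one_le (hl : EigenvaluesNear ε lam) : ∑ a, |lam a - 1| ≤ d * ε := by
  refine (Finset.sum_le_sum fun a _ => hl.abs_sub_one_le a).trans ?_
  simp

/-- With `z = lam - 1` and `s = ∑ (1 / lam - 1)`, the sum is `∑ (z² + s lam z)`; since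
`s = -∑ z + ∑ z² / lam`, the second part is `-(∑ z)²` up to `O(ε ∑ z²)`. -/
lemma sum_zeroth_le (hl : EigenvaluesNear ε lam) :
    ∑ a, (lam a - 1) * ((∑ b, (lam b)⁻¹ - (d - 1)) * lam a - 1)
      ≤ (1 + 3 * d * ε) * ∑ a, (lam a - 1) ^ 2 := by
  set q := ∑ a, (lam a - 1) ^ 2 with hq
  set S := ∑ a, (lam a - 1) with hS
  set q' := ∑ a, (lam a)⁻¹ * (lam a - 1) ^ 2 with hq'
  have hε := hl.pos
  have hs : ∑ b, (lam b)⁻¹ - (d - 1) = 1 + (q' - S) := by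
    have : ∀ b, (lam b)⁻¹ = 1 + ((lam b)⁻¹ * (lam b - 1) ^ 2 - (lam b - 1)) := fun b => by
      have := (hl.lam_pos b).ne'
      field_simp; ring
    rw [Finset.sum_congr rfl fun b _ => this b, Finset.sum_add_distrib, Finset.sum_sub_distrib]
    simp [hq', hS]; ring
  have hsum : ∑ a, (lam a - 1) * ((∑ b, (lam b)⁻¹ - (d - 1)) * lam a - 1)
      = q + (q' - S) * (S + q) := by
    rw [hs, hq, hS, ← Finset.sum_add_distrib, Finset.mul_sum, ← Finset.sum_add_distrib]
    exact Finset.sum_congr rfl fun a _ => by ring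
  have hq0 : 0 ≤ q := Finset.sum_nonneg fun a _ => sq_nonneg _
  have hq'0 : 0 ≤ q' := Finset.sum_nonneg fun a _ =>
    mul_nonneg (inv_nonneg.mpr (hl.lam_pos a).le) (sq_nonneg _)
  have hq'q : q' ≤ 2 * q := by
    rw [hq, Finset.mul_sum]
    exact Finset.sum_le_sum fun a _ => mul_le_mul_of_nonneg_right (hl.inv_le a) (sq_nonneg _)
  have hSb : |S| ≤ d * ε := (Finset.abs_sum_le_sum_abs _ _).trans hl.sum_abs_sub_one_le
  have hqb : q ≤ d * ε := by
    refine le_trans (Finset.sum_le_sum fun a _ => ?_) hl.sum_abs_sub_one_le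
    rw [← sq_abs]
    have h1 := hl.abs_sub_one_le a
    have h2 := abs_nonneg (lam a - 1)
    nlinarith [hl.le_one]
  have h1 : S * (q' - q) ≤ d * ε * q := by
    refine (le_abs_self _).trans ?_
    rw [abs_mul]
    exact mul_le_mul hSb (abs_le.mpr ⟨by linarith, by linarith⟩) (abs_nonneg _)
      ((abs_nonneg _).trans hSb)
  have h2 : q' * q ≤ 2 * q * (d * ε) := mul_le_mul hq'q hqb hq0 (by linarith)
  rw [hsum]
  nlinarith [sq_nonneg S]

end EigenvaluesNear

namespace IsFrame

/-- The zeroth order terms; in dimension `d = n + 1`, the constant `d - 1` is `n`. -/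
lemma ip_zeroth_le (hP : IsFrame H G P lam) (hl : EigenvaluesNear ε lam) :
    ip H⁻¹ (G - H) (((G⁻¹ * H).trace - (d - 1 : ℝ)) • G - H)
      ≤ (1 + 3 * d * ε) * normSq2 H (G - H) := by
  have htr : (G⁻¹ * H).trace = ∑ b, (lam b)⁻¹ := by
    have h1 : (G⁻¹ * H).trace = ∑ i, ∑ j, G⁻¹ i j * H j i := by
      simp [Matrix.trace, Matrix.mul_apply]
    rw [h1, hP.sum_inv_right fun i j => H j i]
    refine Finset.sum_congr rfl fun a _ => ?_
    rw [ev_comm a a fun i j => H j i, hP.ev_ev_left, if_pos rfl, mul_one]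
  rw [hP.ip_sub_eq, hP.normSq2_sub_eq, htr]
  simp only [Matrix.sub_apply, Matrix.smul_apply, smul_eq_mul, ev_sub, ev_mul_left,
    hP.ev_ev_left, hP.ev_ev_right, if_true]
  exact hl.sum_zeroth_le

/-- The gradient term controls `|X|²` for `h`, as `G⁻¹ ≥ (1 - ε) H⁻¹`. -/
lemma le_sum_inv_mul_ip (hP : IsFrame H G P lam) (hl : EigenvaluesNear ε lam)
    (X : Fin d → Matrix (Fin d) (Fin d) ℝ) :
    (1 - ε) * normSq3 H (fun a i j => X a i j)
      ≤ ∑ i, ∑ j, G⁻¹ i j * ip H⁻¹ (X i) (X j) := by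
  rw [hP.sum_inv_right, hP.normSq3_eq, Finset.mul_sum]
  refine Finset.sum_le_sum fun a _ => ?_
  have h1 : ev P a (fun i => ev P a (fun j => ip H⁻¹ (X i) (X j)))
      = ∑ b, ∑ c, ev P a (fun i => ev P b (fun j => ev P c (fun k => X i j k))) ^ 2 := by
    simp only [hP.ip_eq, ev_sum, ev_mul_left, ev_mul_right, sq]
  rw [h1]
  exact mul_le_mul_of_nonneg_right (hl.one_sub_le_inv a)
    (Finset.sum_nonneg fun b _ => Finset.sum_nonneg fun c _ => sq_nonneg _)

/-- The quadratic terms, paired with `G - H`, are absorbed by the gradient term up to `O(ε)`. -/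
lemma abs_ip_quadTerm_le (hP : IsFrame H G P lam) (hl : EigenvaluesNear ε lam)
    (X : Fin d → Matrix (Fin d) (Fin d) ℝ) :
    |ip H⁻¹ (G - H) (quadTerm G⁻¹ X)|
      ≤ 92 * d ^ 3 * ε * normSq3 H (fun a i j => X a i j) := by
  set N := normSq3 H (fun a i j => X a i j) with hN
  have hN0 : 0 ≤ N := by
    rw [hN, hP.normSq3_eq]
    exact Finset.sum_nonneg fun a _ => Finset.sum_nonneg fun b _ =>
      Finset.sum_nonneg fun c _ => sq_nonneg _
  have hX : FrameBdd P (Real.sqrt N) fun i j k => X i j k := fun a b c =>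
    Real.abs_le_sqrt (hP.sq_le_normSq3 (fun i j k => X i j k) a b c)
  have hev : ∀ a, ev P a (fun j => ev P a (fun k => quadTerm G⁻¹ X j k))
      = ∑ c, (lam c)⁻¹ * ∑ e, (lam e)⁻¹ * ev P a (fun j => ev P a (fun k =>
        ev P c (fun i => ev P c (fun m => ev P e (fun r => ev P e (fun s =>
          quadTensor X j k i m r s)))))) := fun a => by
    simp only [quadTerm, Matrix.of_apply, hP.sum_inv_right, ev_sum, ev_mul_left]
  have hinv : ∀ c, |(lam c)⁻¹| ≤ 2 := fun c => by
    rw [abs_of_pos (inv_pos.mpr (hl.lam_pos c))]; exact hl.inv_le c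
  have hb : ∀ a, |ev P a (fun j => ev P a (fun k => quadTerm G⁻¹ X j k))|
      ≤ 92 * d ^ 2 * N := fun a => by
    rw [hev]
    have h1 : ∀ c e, |(lam e)⁻¹ * ev P a (fun j => ev P a (fun k =>
        ev P c (fun i => ev P c (fun m => ev P e (fun r => ev P e (fun s =>
          quadTensor X j k i m r s))))))| ≤ 2 * (23 * N) := fun c e => by
      rw [abs_mul]
      refine mul_le_mul (hinv e) ?_ (abs_nonneg _) (by norm_num)
      have := abs_ev_quadTensor_le hX a c e
      rwa [Real.sq_sqrt hN0] at this
    have h2 : ∀ c, |(lam c)⁻¹ * ∑ e, (lam e)⁻¹ * ev P a (fun j => ev P a (fun k =>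
        ev P c (fun i => ev P c (fun m => ev P e (fun r => ev P e (fun s =>
          quadTensor X j k i m r s))))))| ≤ 2 * (d * (2 * (23 * N))) := fun c => by
      rw [abs_mul]
      refine mul_le_mul (hinv c) ?_ (abs_nonneg _) (by norm_num)
      refine (Finset.abs_sum_le_sum_abs _ _).trans
        ((Finset.sum_le_sum fun e _ => h1 c e).trans_eq (by simp))
    refine (Finset.abs_sum_le_sum_abs _ _).trans
      ((Finset.sum_le_sum fun c _ => h2 c).trans_eq ?_)
    simp; ring
  rw [hP.ip_sub_eq]
  refine (Finset.abs_sum_le_sum_abs _ _).trans ?_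
  have h3 : ∀ a, |(lam a - 1) * ev P a (fun j => ev P a (fun k => quadTerm G⁻¹ X j k))|
      ≤ |lam a - 1| * (92 * d ^ 2 * N) := fun a => by
    rw [abs_mul]; exact mul_le_mul_of_nonneg_left (hb a) (abs_nonneg _)
  refine (Finset.sum_le_sum fun a _ => h3 a).trans ?_
  rw [← Finset.sum_mul]
  refine (mul_le_mul_of_nonneg_right hl.sum_abs_sub_one_le (by positivity)).trans_eq ?_
  ring

/-- The curvature error is quadratic in `G - H`: replacing `G⁻¹` by `H⁻¹` in the contraction of
`E` gives zero. -/
lemma abs_ip_error_le (hP : IsFrame H G P lam) (hl : EigenvaluesNear ε lam)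
    {E : Fin d → Fin d → Fin d → Fin d → ℝ} {η : ℝ}
    (hE : Real.sqrt (normSq4 H E) ≤ η) (htr : ∀ j q, ∑ a, ∑ b, H⁻¹ a b * E j a q b = 0) :
    |ip H⁻¹ (G - H) (Matrix.of fun i j => ∑ a, ∑ b, ∑ p, ∑ q,
        G⁻¹ a b * G i p * H⁻¹ p q * E j a q b)| ≤ 4 * d * η * normSq2 H (G - H) := by
  have hη : 0 ≤ η := (Real.sqrt_nonneg _).trans hE
  set W : Fin d → Fin d → ℝ := fun c e =>
    ev P c (fun j => ev P e (fun a => ev P c (fun q => ev P e (fun b => E j a q b)))) with hW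
  have hWη : ∀ c e, |W c e| ≤ η := fun c e =>
    (Real.abs_le_sqrt (hP.sq_le_normSq4 E c e c e)).trans hE
  have hWsum : ∀ c, ∑ e, W c e = 0 := fun c => by
    have h1 : ∀ j q, ∑ e, ev P e (fun a => ev P e (fun b => E j a q b)) = 0 := fun j q => by
      rw [← hP.sum_inv_left, htr]
    have h2 : ∑ e, ev P c (fun j => ev P c (fun q => ev P e (fun a => ev P e (fun b =>
        E j a q b)))) = 0 := by
      simp only [← ev_sum, h1, ev_zero]
    rw [← h2]
    refine Finset.sum_congr rfl fun e _ => ?_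
    simp only [hW]
    congr 1
    funext j
    exact ev_comm e c _
  have hev : ∀ c, ev P c (fun i => ev P c (fun j => ∑ a, ∑ b, ∑ p, ∑ q,
        G⁻¹ a b * G i p * H⁻¹ p q * E j a q b)) = lam c * ∑ e, ((lam e)⁻¹ - 1) * W c e :=
    fun c => by
      have h1 : ∀ i j, ∑ a, ∑ b, ∑ p, ∑ q, G⁻¹ a b * G i p * H⁻¹ p q * E j a q b
          = ∑ e, (lam e)⁻¹ * ev P e (fun a => ev P e (fun b =>
            ∑ p, ∑ q, G i p * H⁻¹ p q * E j a q b)) := fun i j => by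
        rw [← hP.sum_inv_right]
        simp only [Finset.mul_sum, mul_assoc]
      have h2 : ∀ e, ev P c (fun i => ev P c (fun j => ev P e (fun a => ev P e (fun b =>
            ∑ p, ∑ q, G i p * H⁻¹ p q * E j a q b)))) = lam c * W c e := fun e => by
        have h3 : ∀ j a, ev P c (fun i => ev P e (fun b =>
            ∑ p, ∑ q, G i p * H⁻¹ p q * E j a q b))
            = lam c * ev P c (fun q => ev P e (fun b => E j a q b)) := fun j a => by
          rw [ev_comm]
          simp only [hP.ev_sum_mul_inv c fun q => E j a q _]
          rw [ev_mul_left, ev_comm]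
        rw [ev_comm]
        have h4 : ∀ j, ev P c (fun i => ev P e (fun a => ev P e (fun b =>
            ∑ p, ∑ q, G i p * H⁻¹ p q * E j a q b)))
            = lam c * ev P e (fun a => ev P c (fun q => ev P e (fun b => E j a q b))) :=
          fun j => by
            rw [ev_comm]; simp only [h3, ev_mul_left]
        simp only [h4, ev_mul_left, hW]
      simp only [h1, ev_sum_mul_left, h2, sub_mul, one_mul, Finset.sum_sub_distrib, hWsum,
        sub_zero, Finset.mul_sum]
      exact Finset.sum_congr rfl fun e _ => by ring
  rw [hP.ip_sub_eq, hP.normSq2_sub_eq]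
  simp only [Matrix.of_apply, hev]
  set S := ∑ a, |lam a - 1| with hS
  have hS0 : 0 ≤ S := Finset.sum_nonneg fun a _ => abs_nonneg _
  have h5 : ∀ c, |∑ e, ((lam e)⁻¹ - 1) * W c e| ≤ 2 * S * η := fun c => by
    refine (Finset.abs_sum_le_sum_abs _ _).trans ?_
    rw [hS, Finset.mul_sum, Finset.sum_mul]
    refine Finset.sum_le_sum fun e _ => ?_
    rw [abs_mul]
    exact mul_le_mul (hl.abs_inv_sub_one_le e) (hWη c e) (abs_nonneg _) (by positivity)
  have h6 : ∀ c, |(lam c - 1) * (lam c * ∑ e, ((lam e)⁻¹ - 1) * W c e)|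
      ≤ |lam c - 1| * (2 * (2 * S * η)) := fun c => by
    rw [abs_mul, abs_mul, abs_of_pos (hl.lam_pos c)]
    exact mul_le_mul_of_nonneg_left
      (mul_le_mul (hl.lam_le_two c) (h5 c) (abs_nonneg _) (by norm_num)) (abs_nonneg _)
  refine (Finset.abs_sum_le_sum_abs _ _).trans ((Finset.sum_le_sum fun c _ => h6 c).trans ?_)
  rw [← Finset.sum_mul, ← hS]
  have h7 : S ^ 2 ≤ d * ∑ a, (lam a - 1) ^ 2 := by
    have := sq_sum_le_card_mul_sum_sq (s := Finset.univ) (f := fun a => |lam a - 1|)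
    simpa using this
  calc S * (2 * (2 * S * η)) = 4 * η * S ^ 2 := by ring
    _ ≤ 4 * η * (d * ∑ a, (lam a - 1) ^ 2) := mul_le_mul_of_nonneg_left h7 (by positivity)
    _ = _ := by ring

end IsFrame

end

noncomputable section

/-! ### The differential inequality -/

/-- In the interior, an admissible metric inherits its regularity from the compactified metric. -/
lemma IsAdmissibleEinstein.isC2Metric {n : ℕ} {η : ℝ} {h : TensorField (n + 1)}
    (hh : IsAdmissibleEinstein n η h) : IsC2Metric (ball 0 1) h := by
  obtain ⟨hbar, heq, ⟨hpos, α, -, -, hreg⟩, -⟩ := hh.conformallyCompact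
  have hρ : ∀ x ∈ ball (0 : Pt (n + 1)) 1, 0 < (1 - ‖x‖ ^ 2) ^ 2 := fun x hx => by
    rw [mem_ball_zero_iff] at hx
    have : 0 < 1 - ‖x‖ ^ 2 := by nlinarith [norm_nonneg x]
    positivity
  have hh' : ∀ x ∈ ball (0 : Pt (n + 1)) 1, h x = ((1 - ‖x‖ ^ 2) ^ 2)⁻¹ • hbar x :=
    fun x hx => by rw [heq x hx, smul_smul, inv_mul_cancel₀ (hρ x hx).ne', one_smul]
  refine ⟨isOpen_ball, fun x hx => ?_, fun x hx i j => ?_⟩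
  · rw [hh' x hx]
    exact (hpos x (ball_subset_closedBall hx)).smul (inv_pos.mpr (hρ x hx))
  · have h1 : ContDiffAt ℝ 2 (fun y => hbar y i j) x :=
      ((hreg i j).1.contDiffAt (closedBall_mem_nhds_of_mem hx)).of_le (by norm_num)
    have h2 : ContDiffAt ℝ 2 (fun y : Pt (n + 1) => ((1 - ‖y‖ ^ 2) ^ 2)⁻¹) x :=
      ContDiffAt.inv ((contDiffAt_const.sub (contDiff_norm_sq ℝ).contDiffAt).pow 2) (hρ x hx).ne'
    refine (h2.mul h1).congr_of_eventuallyEq ?_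
    filter_upwards [isOpen_ball.mem_nhds hx] with y hy
    rw [hh' y hy]; rfl

/-- Joint `C²` regularity restricts to each time slice. -/
lemma IsMetricFamily.isC2Metric {d : ℕ} {T : ℝ} {g : ℝ → TensorField d}
    (hg : IsMetricFamily 2 (Ioo 0 T) g) {t : ℝ} (ht : t ∈ Ioo 0 T) :
    IsC2Metric (ball 0 1) (g t) := by
  refine ⟨isOpen_ball, hg.1 t ht, fun x hx i j => ?_⟩
  have h1 : ContDiffAt ℝ 2 (fun p : ℝ × Pt d => g p.1 p.2 i j) (t, x) :=
    (hg.2 i j).contDiffAt ((isOpen_Ioo.prod isOpen_ball).mem_nhds ⟨ht, hx⟩)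
  exact h1.comp x (f := fun y => (t, y)) (contDiffAt_const.prodMk contDiffAt_id)

/-- For an Einstein metric with `Rc = -n h`, the trace of the curvature deviation `E` vanishes. -/
lemma IsC2Metric.sum_inv_mul_curvatureError {n : ℕ} {U : Set (Pt (n + 1))}
    {h : TensorField (n + 1)} (hh : IsC2Metric U h) {x : Pt (n + 1)} (hx : x ∈ U)
    (hE : ∀ i j, ricci h i j x = -(n : ℝ) * h x i j) (j q : Fin (n + 1)) :
    ∑ a, ∑ b, (h x)⁻¹ a b * curvatureError h j a q b x = 0 := by
  have hR : ∀ a, ∑ b, (h x)⁻¹ a b * riemann h j a q b x = -riemannUp h a j q a x := fun a => by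
    have h1 : ((h x)⁻¹ * (h x * curvM h j a x)) a q = riemannUp h j a q a x := by
      rw [← Matrix.mul_assoc, hh.inv_mul hx, Matrix.one_mul]; rfl
    rw [← riemannUp_antisymm, ← h1, Matrix.mul_apply]
    exact Finset.sum_congr rfl fun b _ => by simp [riemann, Matrix.mul_apply, curvM]
  have h1 : ∑ a, ∑ b, (h x)⁻¹ a b * (h x j b * h x a q) = h x j q := by
    have : (h x * ((h x)⁻¹ * h x)) j q = h x j q := by
      rw [hh.inv_mul hx, Matrix.mul_one]
    rw [← this, Matrix.mul_apply, Finset.sum_comm]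
    refine Finset.sum_congr rfl fun b _ => ?_
    rw [Matrix.mul_apply, Finset.mul_sum]
    exact Finset.sum_congr rfl fun a _ => by rw [hh.inv_symm hx a b]; ring
  have h2 : ∑ a, ∑ b, (h x)⁻¹ a b * (h x j q * h x a b) = (n + 1) * h x j q := by
    have h3 : ∀ a, ∑ b, (h x)⁻¹ a b * (h x j q * h x a b) = h x j q := fun a => by
      have : ((h x)⁻¹ * h x) a a = 1 := by rw [hh.inv_mul hx, Matrix.one_apply_eq]
      rw [Matrix.mul_apply] at this
      refine Eq.trans ?_ ((congrArg (h x j q * ·) this).trans (mul_one _))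
      rw [Finset.mul_sum]
      exact Finset.sum_congr rfl fun b _ => by rw [hh.symm hx b a]; ring
    simp [h3]
  simp only [curvatureError, curvatureCC, mul_add, mul_sub, Finset.sum_add_distrib,
    Finset.sum_sub_distrib, hR, h1, h2, Finset.sum_neg_distrib]
  have h4 : ∑ a, riemannUp h a j q a x = -(n : ℝ) * h x j q := hE j q
  rw [h4]; ring

end

theorem lemma6 (n : ℕ) :
    ∃ b c ε₀ : ℝ, 0 < b ∧ 0 < c ∧ 0 < ε₀ ∧
      ∀ (η : ℝ) (h : TensorField (n + 1)), IsAdmissibleEinstein n η h →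
      ∀ (ε : ℝ), 0 < ε → ε ≤ ε₀ →
      ∀ (T : ℝ) (g : ℝ → TensorField (n + 1)),
        IsMetricFamily 2 (Ioo 0 T) g →
        IsNormalizedRicciDeTurckFlow n h (Ioo 0 T) g →
        (∀ t ∈ Ioo 0 T, IsEpsClose ε h (g t)) →
        ∀ t ∈ Ioo 0 T, ∀ x ∈ ball (0 : Pt (n + 1)) 1,
          deriv (fun s => normSq2 (h x) (g s x - h x)) t
              ≤ (∑ i, ∑ j, (g t x)⁻¹ i j * hess h (fun y => normSq2 (h y) (g t y - h y)) i j x)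
                - (2 - c * ε) * normSq3 (h x) (nabla2 h (fun y => g t y - h y) · · · x)
                + (4 + c * ε + b * η) * normSq2 (h x) (g t x - h x) ∧
          |curvatureErrorTerm h (g t) x| ≤ b * η * normSq2 (h x) (g t x - h x) := by
  refine ⟨16 * (n + 1 : ℕ), 200 * ((n + 1 : ℕ) : ℝ) ^ 3, 1, by positivity, by positivity,
    one_pos, fun η h hh ε hε hε1 T g hg hflow hclose t ht x hx => ?_⟩
  have hhm := hh.isC2Metric
  have hgm := hg.isC2Metric ht
  obtain ⟨P, lam, hP⟩ := exists_isFrame (hhm.posDef x hx) (hgm.posDef x hx)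
  have hl : EigenvaluesNear ε lam := ⟨hε, hε1, hP.bounds (hclose t ht x hx)⟩
  have hd1 : (1 : ℝ) ≤ (n + 1 : ℕ) := by exact_mod_cast Nat.le_add_left 1 n
  have herr : |curvatureErrorTerm h (g t) x|
      ≤ 16 * (n + 1 : ℕ) * η * normSq2 (h x) (g t x - h x) := by
    have := hP.abs_ip_error_le hl (hh.curvature_le x hx)
      (hhm.sum_inv_mul_curvatureError hx (hh.einstein x hx))
    rw [curvatureErrorTerm_eq_ip (hhm.inv_transpose hx), abs_mul, abs_of_pos (by norm_num)]
    unfold errorTensor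
    linarith
  refine ⟨?_, herr⟩
  have hderiv := (hasDerivAt_normSq2 (hhm.inv_transpose hx)
    (D := flowField n h (g t) x) (fun i j => hflow t ht x hx i j)).deriv
  have hN : normSq3 (h x) (nabla2 h (fun y => g t y - h y) · · · x)
      = normSq3 (h x) (fun a i j => cov h a (g t) x i j) := by
    congr 1
    funext a i j
    rw [← cov_apply, hgm.cov_sub_self hhm hx]
  rw [hderiv, hgm.ip_flowField hhm hx, hN]
  have e0 := hP.ip_zeroth_le hl
  have e1 := hP.le_sum_inv_mul_ip hl (fun a => cov h a (g t) x)
  have e2 := hP.abs_ip_quadTerm_le hl (fun a => cov h a (g t) x)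
  have hN0 : 0 ≤ normSq3 (h x) (fun a i j => cov h a (g t) x i j) :=
    (sq_nonneg _).trans (hP.sq_le_normSq3 _ 0 0 0)
  have hZ0 : 0 ≤ normSq2 (h x) (g t x - h x) := by
    rw [hP.normSq2_sub_eq]; exact Finset.sum_nonneg fun a _ => sq_nonneg _
  rw [show (((n + 1 : ℕ) : ℝ) - 1) = n by push_cast; ring] at e0
  set D : ℝ := ((n + 1 : ℕ) : ℝ)
  set N := normSq3 (h x) (fun a i j => cov h a (g t) x i j)
  set Z := normSq2 (h x) (g t x - h x)
  have hD3 : D ≤ D ^ 3 := le_self_pow₀ hd1 (by norm_num)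
  -- the constant `200 D³` covers `12 D` at zeroth order and `2 + 2 · 92 D³` at first order
  have f1 : 12 * D * ε * Z ≤ 200 * D ^ 3 * ε * Z := by
    gcongr
    linarith
  have f2 : (2 + 184 * D ^ 3) * ε * N ≤ 200 * D ^ 3 * ε * N := by
    gcongr; linarith
  have e2' := (le_abs_self _).trans e2
  have e3 := (le_abs_self _).trans herr
  linarith
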